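/- Let $n,k\ge 0$ be integers and let $\mathfrak g=\mathfrak h_{2n+1}\times\mathbb R^{2k+1}$, where $\mathfrak h_{2n+1}$ is the real Heisenberg Lie algebra of dimension $2n+1$; thus $\mathfrak g$ has a basis $e_1,\dots,e_{2n},z_0,\dots,z_{2k+1}$ whose only nonzero brackets, up to skew-symmetry, are $[e_{2i-1},e_{2i}]=z_0$ for $1\le i\le n$. A complex structure on $\mathfrak g$ is an endomorphism $J$ with $J^2=-\mathrm{Id}$ and $[JX,JY]-J[JX,Y]-J[X,JY]-[X,Y]=0$ for all $X,Y\in\mathfrak g$; it is abelian if $[JX,JY]=[X,Y]$ for all $X,Y$. Two complex structures $J,J'$ are equivalent if $\varphi J=J'\varphi$ for some Lie algebra automorphism $\varphi$ of $\mathfrak g$. A balanced metric for $J$ is an inner product $g$ on $\mathfrak g$ with $g(JX,JY)=g(X,Y)$ for all $X,Y$ and such that, for $F(X,Y)=g(X,JY)$ and $2N=\dim\mathfrak g$, the form $F^{N-1}$ is closed with respect to the Chevalley–Eilenberg differential. An equivalence class admits balanced metrics if some $J$ in it admits one. Then there are exactly $\lfloor n/2\rfloor+1$ equivalence classes of abelian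 complex structures on $\mathfrak g$. If $n\ge 2$, exactly $\lfloor n/2\rfloor$ of these classes admit balanced metrics, and the class of the abelian complex structure $J_0$ given by $J_0e_{2i-1}=e_{2i}$ $(1\le i\le n)$, $J_0z_{2j}=-z_{2j+1}$ $(0\le j\le k)$ admits none. -/

import Mathlib

namespace LieHermitian

/-! ### Complex structures on a real Lie algebra -/

section General

variable (L : Type*) [LieRing L] [LieAlgebra ℝ L]

/-- A complex structure on a real Lie algebra: an endomorphism `J` with `J² = -1` whose Nijenhuis
form `N(X,Y) = [JX,JY] - J[JX,Y] - J[X,JY] - [X,Y]` vanishes. -/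
structure ComplexStructure where
  J : L →ₗ[ℝ] L
  sq : ∀ X, J (J X) = -X
  nijenhuis : ∀ X Y, ⁅J X, J Y⁆ - J ⁅J X, Y⁆ - J ⁅X, J Y⁆ - ⁅X, Y⁆ = 0

variable {L}

/-- The complex structure is of abelian type. -/
def ComplexStructure.IsAbelian (J : ComplexStructure L) : Prop :=
  ∀ X Y : L, ⁅J.J X, J.J Y⁆ = ⁅X, Y⁆

/-- Two complex structures are equivalent if a Lie algebra automorphism intertwines them. -/
def ComplexStructure.Equivalent (J J' : ComplexStructure L) : Prop :=
  ∃ φ : L ≃ₗ⁅ℝ⁆ L, ∀ X, φ (J.J X) = J'.J (φ X)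

variable (L) in
/-- The abelian complex structures on `L`. -/
abbrev AbelianComplexStructure : Type _ := {J : ComplexStructure L // J.IsAbelian}

instance equivalenceSetoid : Setoid (AbelianComplexStructure L) where
  r J J' := J.1.Equivalent J'.1
  iseqv :=
    { refl := fun _ => ⟨LieEquiv.refl, fun _ => rfl⟩
      symm := fun {J J'} ⟨φ, h⟩ => ⟨φ.symm, fun X => by
        have h1 := h (φ.symm X)
        rw [φ.apply_symm_apply] at h1
        rw [← h1, φ.symm_apply_apply]⟩
      trans := fun {J J' J''} ⟨φ, h⟩ ⟨ψ, h'⟩ => ⟨φ.trans ψ, fun X => by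
        rw [LieEquiv.trans_apply, LieEquiv.trans_apply, h, h']⟩ }

variable (L) in
/-- The equivalence classes of abelian complex structures on `L`. -/
def AbelianComplexClass : Type _ := Quotient (equivalenceSetoid (L := L))

/-- The equivalence class of an abelian complex structure. -/
def AbelianComplexStructure.toClass (J : AbelianComplexStructure L) : AbelianComplexClass L :=
  Quotient.mk _ J

/-! ### Hermitian metrics -/

/-- A Hermitian metric for `J`: an inner product on `L` with `g(JX, JY) = g(X, Y)`. -/
structure HermitianMetric (J : ComplexStructure L) where
  g : LinearMap.BilinForm ℝ L
  symm : ∀ X Y, g X Y = g Y X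
  pos : ∀ X, X ≠ 0 → 0 < g X X
  compat : ∀ X Y, g (J.J X) (J.J Y) = g X Y

theorem HermitianMetric.apply_J_self {J : ComplexStructure L} (h : HermitianMetric J) (X : L) :
    h.g X (J.J X) = 0 := by
  have h1 := h.compat X (J.J X)
  rw [J.sq, map_neg, h.symm] at h1
  linarith

/-- The fundamental form `F(X, Y) = g(X, JY)`. -/
def HermitianMetric.fundamentalForm {J : ComplexStructure L} (h : HermitianMetric J) :
    L [⋀^Fin 2]→ₗ[ℝ] ℝ where
  toFun v := h.g (v 0) (J.J (v 1))
  map_update_add' := by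
    intro inst v i x y
    rw [Subsingleton.elim inst (instDecidableEqFin 2)]
    fin_cases i <;> simp [Function.update]
  map_update_smul' := by
    intro inst v i c x
    rw [Subsingleton.elim inst (instDecidableEqFin 2)]
    fin_cases i <;> simp [Function.update]
  map_eq_zero_of_eq' := by
    intro v i j hv hij
    have h01 : v 0 = v 1 := by
      fin_cases i <;> fin_cases j <;> simp_all
    change h.g (v 0) (J.J (v 1)) = 0
    rw [← h01]
    exact h.apply_J_self (v 0)

/-! ### Forms on a Lie algebra: exterior product, powers, differential -/

/-- The exterior product of alternating forms. -/
noncomputable def wedge {p q : ℕ} (a : L [⋀^Fin p]→ₗ[ℝ] ℝ) (b : L [⋀^Fin q]→ₗ[ℝ] ℝ) :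
    L [⋀^Fin (p + q)]→ₗ[ℝ] ℝ :=
  ((LinearMap.mul' ℝ ℝ).compAlternatingMap (a.domCoprod b)).domDomCongr finSumFinEquiv

/-- The exterior power `F^m = F ∧ ⋯ ∧ F` of a `2`-form. -/
noncomputable def wedgePow (F : L [⋀^Fin 2]→ₗ[ℝ] ℝ) : (m : ℕ) → L [⋀^Fin (2 * m)]→ₗ[ℝ] ℝ
  | 0 => (AlternatingMap.constOfIsEmpty ℝ L (Fin 0) (1 : ℝ) : L [⋀^Fin 0]→ₗ[ℝ] ℝ)
  | m + 1 => wedge (wedgePow F m) F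

/-- The Chevalley–Eilenberg differential (trivial coefficients) of a `p`-form, as a function of
`p + 1` vectors:
`dω(x₀, …, x_p) = ∑_{i < j} (-1)^(i+j) ω([x_i, x_j], x₀, …, x̂_i, …, x̂_j, …, x_p)`,
and `d = 0` on constants. In degree one this is `dα(X, Y) = -α([X, Y])`. -/
def ceDiff : {p : ℕ} → (L [⋀^Fin p]→ₗ[ℝ] ℝ) → (Fin (p + 1) → L) → ℝ
  | 0, _, _ => 0
  | p + 1, ω, x =>
    ∑ i : Fin (p + 1), ∑ j : Fin (p + 2),
      if i.castSucc < j then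
        (-1 : ℝ) ^ ((i : ℕ) + (j : ℕ)) *
          ω (Fin.cons ⁅x i.castSucc, x j⁆ (i.removeNth (j.removeNth x)) : Fin (p + 1) → L)
      else 0

/-- A form is closed if its Chevalley–Eilenberg differential vanishes. -/
def IsClosedForm {p : ℕ} (ω : L [⋀^Fin p]→ₗ[ℝ] ℝ) : Prop := ∀ x, ceDiff ω x = 0

/-- A Hermitian metric is balanced if `F^(N-1)` is closed, where `dim L = 2N`. -/
def HermitianMetric.IsBalanced {J : ComplexStructure L} (h : HermitianMetric J) : Prop :=
  IsClosedForm (wedgePow h.fundamentalForm (Module.finrank ℝ L / 2 - 1))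

/-- The complex structure admits a balanced (Hermitian) metric. -/
def ComplexStructure.AdmitsBalanced (J : ComplexStructure L) : Prop :=
  ∃ h : HermitianMetric J, h.IsBalanced

/-- An equivalence class admits balanced metrics if some representative does. -/
def AbelianComplexClass.AdmitsBalanced (c : AbelianComplexClass L) : Prop :=
  ∃ J : AbelianComplexStructure L, J.toClass = c ∧ J.1.AdmitsBalanced

end General

/-! ### The Lie algebra `𝔥_{2n+1} × ℝ^m` -/

/-- The real Heisenberg Lie algebra of dimension `2n+1`. The element `(x, y, t)` stands for
`∑ (x_i e_{2i-1} + y_i e_{2i}) + t z₀`, where `[e_{2i-1}, e_{2i}] = z₀` are the only nonzero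
brackets of basis vectors (up to skew-symmetry). -/
def Heisenberg (n : ℕ) : Type := (Fin n → ℝ) × (Fin n → ℝ) × ℝ

namespace Heisenberg

variable {n : ℕ}

instance : AddCommGroup (Heisenberg n) :=
  inferInstanceAs (AddCommGroup ((Fin n → ℝ) × (Fin n → ℝ) × ℝ))

noncomputable instance : Module ℝ (Heisenberg n) :=
  inferInstanceAs (Module ℝ ((Fin n → ℝ) × (Fin n → ℝ) × ℝ))

noncomputable instance : LieRing (Heisenberg n) where
  bracket u v := ((0, 0, ∑ i, (u.1 i * v.2.1 i - u.2.1 i * v.1 i)) :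
    (Fin n → ℝ) × (Fin n → ℝ) × ℝ)
  add_lie u v w := by
    refine Prod.ext (add_zero 0).symm (Prod.ext (add_zero 0).symm ?_)
    change ∑ i, ((u.1 i + v.1 i) * w.2.1 i - (u.2.1 i + v.2.1 i) * w.1 i) =
      ∑ i, (u.1 i * w.2.1 i - u.2.1 i * w.1 i) + ∑ i, (v.1 i * w.2.1 i - v.2.1 i * w.1 i)
    rw [← Finset.sum_add_distrib]
    exact Finset.sum_congr rfl fun i _ => by ring
  lie_add u v w := by
    refine Prod.ext (add_zero 0).symm (Prod.ext (add_zero 0).symm ?_)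
    change ∑ i, (u.1 i * (v.2.1 i + w.2.1 i) - u.2.1 i * (v.1 i + w.1 i)) =
      ∑ i, (u.1 i * v.2.1 i - u.2.1 i * v.1 i) + ∑ i, (u.1 i * w.2.1 i - u.2.1 i * w.1 i)
    rw [← Finset.sum_add_distrib]
    exact Finset.sum_congr rfl fun i _ => by ring
  lie_self u := by
    refine Prod.ext rfl (Prod.ext rfl ?_)
    change ∑ i, (u.1 i * u.2.1 i - u.2.1 i * u.1 i) = 0
    exact Finset.sum_eq_zero fun i _ => by ring
  leibniz_lie u v w := by
    refine Prod.ext (add_zero 0).symm (Prod.ext (add_zero 0).symm ?_)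
    change ∑ i, (u.1 i * (0 : ℝ) - u.2.1 i * (0 : ℝ)) =
      ∑ i, ((0 : ℝ) * w.2.1 i - (0 : ℝ) * w.1 i) + ∑ i, (v.1 i * (0 : ℝ) - v.2.1 i * (0 : ℝ))
    simp

noncomputable instance : LieAlgebra ℝ (Heisenberg n) where
  lie_smul c u v := by
    refine Prod.ext (smul_zero c).symm (Prod.ext (smul_zero c).symm ?_)
    change ∑ i, (u.1 i * (c * v.2.1 i) - u.2.1 i * (c * v.1 i)) =
      c * ∑ i, (u.1 i * v.2.1 i - u.2.1 i * v.1 i)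
    rw [Finset.mul_sum]
    exact Finset.sum_congr rfl fun i _ => by ring

end Heisenberg

/-- The abelian Lie algebra `ℝ^m`. -/
def AbelianLie (m : ℕ) : Type := Fin m → ℝ

namespace AbelianLie

variable {m : ℕ}

instance : AddCommGroup (AbelianLie m) := inferInstanceAs (AddCommGroup (Fin m → ℝ))

noncomputable instance : Module ℝ (AbelianLie m) := inferInstanceAs (Module ℝ (Fin m → ℝ))

instance : LieRing (AbelianLie m) where
  bracket _ _ := 0
  add_lie _ _ _ := (add_zero 0).symm
  lie_add _ _ _ := (add_zero 0).symm
  lie_self _ := rfl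
  leibniz_lie _ _ _ := (add_zero 0).symm

noncomputable instance : LieAlgebra ℝ (AbelianLie m) where
  lie_smul c _ _ := (smul_zero c).symm

end AbelianLie

/-- The Lie algebra `𝔥_{2n+1} × ℝ^{2k+1}`; the product is the product of Lie algebras. -/
abbrev HeisProd (n k : ℕ) : Type := Heisenberg n × AbelianLie (2 * k + 1)

namespace HeisProd

variable {n k : ℕ}

/-- The basis vector `e_{2i-1}` (with `i` counted from `0`). -/
noncomputable def e (i : Fin n) : HeisProd n k :=
  (((Pi.single i 1, 0, 0) : (Fin n → ℝ) × (Fin n → ℝ) × ℝ), (0 : Fin (2 * k + 1) → ℝ))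

/-- The basis vector `e_{2i}` (with `i` counted from `0`). -/
noncomputable def f (i : Fin n) : HeisProd n k :=
  (((0, Pi.single i 1, 0) : (Fin n → ℝ) × (Fin n → ℝ) × ℝ), (0 : Fin (2 * k + 1) → ℝ))

/-- The central basis vectors `z_0, z_1, …, z_{2k+1}`: `z_0` spans the centre of the Heisenberg
factor, the others are the standard basis of `ℝ^{2k+1}`. -/
noncomputable def z : Fin (2 * k + 2) → HeisProd n k :=
  Fin.cons (((0, 0, 1) : (Fin n → ℝ) × (Fin n → ℝ) × ℝ), (0 : Fin (2 * k + 1) → ℝ))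
    fun l => ((0 : (Fin n → ℝ) × (Fin n → ℝ) × ℝ), (Pi.single l 1 : Fin (2 * k + 1) → ℝ))

/-- The coordinates of `u` along `z_0, …, z_{2k+1}`. -/
def zCoord (u : HeisProd n k) : Fin (2 * k + 2) → ℝ := Fin.cons u.1.2.2 u.2

/-- On `ℝ^{2k+2}`: the linear map sending the basis vector `2j` to minus the basis vector `2j+1`
and the basis vector `2j+1` to the basis vector `2j`. -/
def rot (c : Fin (2 * k + 2) → ℝ) (m : Fin (2 * k + 2)) : ℝ :=
  if h : (m : ℕ) % 2 = 0 then c ⟨m + 1, by omega⟩ else -c ⟨m - 1, by omega⟩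

theorem rot_rot (c : Fin (2 * k + 2) → ℝ) : rot (rot c) = -c := by
  funext m
  by_cases h : (m : ℕ) % 2 = 0
  · have h' : ¬ ((m : ℕ) + 1) % 2 = 0 := by omega
    simp [rot, h, h']
  · have h' : ((m : ℕ) - 1) % 2 = 0 := by omega
    have h'' : (m : ℕ) - 1 + 1 = m := by omega
    simp [rot, h, h', h'']

/-- The endomorphism with `e_{2i-1} ↦ e_{2i}`, `e_{2i} ↦ -e_{2i-1}`, `z_{2j} ↦ -z_{2j+1}`,
`z_{2j+1} ↦ z_{2j}`. -/
noncomputable def J₀Map : HeisProd n k →ₗ[ℝ] HeisProd n k where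
  toFun u :=
    (((-u.1.2.1, u.1.1, rot (zCoord u) 0) : (Fin n → ℝ) × (Fin n → ℝ) × ℝ),
      (Fin.tail (rot (zCoord u)) : Fin (2 * k + 1) → ℝ))
  map_add' u v := by
    have hz : zCoord (u + v) = zCoord u + zCoord v := by
      funext m
      refine Fin.cases rfl (fun l => rfl) m
    have hr : rot (zCoord (u + v)) = rot (zCoord u) + rot (zCoord v) := by
      rw [hz]
      funext m
      by_cases h : (m : ℕ) % 2 = 0
      · simp [rot, h]
      · simp [rot, h]; ring
    rw [hr]
    exact Prod.ext (Prod.ext (neg_add _ _) rfl) rfl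
  map_smul' c u := by
    have hz : zCoord (c • u) = c • zCoord u := by
      funext m
      refine Fin.cases rfl (fun l => rfl) m
    have hr : rot (zCoord (c • u)) = c • rot (zCoord u) := by
      rw [hz]
      funext m
      by_cases h : (m : ℕ) % 2 = 0 <;> simp [rot, h]
    rw [hr]
    exact Prod.ext (Prod.ext (smul_neg _ _).symm rfl) rfl

theorem J₀Map_J₀Map (u : HeisProd n k) : J₀Map (J₀Map u) = -u := by
  have hz : zCoord (J₀Map u) = rot (zCoord u) := by
    funext m
    refine Fin.cases rfl (fun l => rfl) m
  have hr : rot (zCoord (J₀Map u)) = -zCoord u := by rw [hz, rot_rot]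
  refine Prod.ext (Prod.ext rfl (Prod.ext rfl ?_)) ?_
  · exact congrFun hr 0
  · change Fin.tail (rot (zCoord (J₀Map u))) = _
    rw [hr]
    rfl

theorem J₀Map_lie (u v : HeisProd n k) : ⁅J₀Map u, J₀Map v⁆ = ⁅u, v⁆ := by
  refine Prod.ext (Prod.ext rfl (Prod.ext rfl ?_)) rfl
  change ∑ i, ((-u.1.2.1 i) * v.1.1 i - u.1.1 i * (-v.1.2.1 i)) =
    ∑ i, (u.1.1 i * v.1.2.1 i - u.1.2.1 i * v.1.1 i)
  exact Finset.sum_congr rfl fun i _ => by ring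

variable (n k) in
/-- The abelian complex structure `J₀` on `𝔥_{2n+1} × ℝ^{2k+1}`. -/
noncomputable def J₀ : AbelianComplexStructure (HeisProd n k) :=
  ⟨{ J := J₀Map
     sq := J₀Map_J₀Map
     nijenhuis := fun X Y => by
      have h : ⁅J₀Map X, Y⁆ = -⁅X, J₀Map Y⁆ := by
        rw [← J₀Map_lie (J₀Map X) Y, J₀Map_J₀Map, neg_lie]
      rw [h, J₀Map_lie, map_neg]
      abel }, J₀Map_lie⟩

/-! The brackets and the structure `J₀` on the basis vectors. -/

theorem lie_e_f (i : Fin n) : ⁅(e i : HeisProd n k), (f i : HeisProd n k)⁆ = z 0 := by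
  refine Prod.ext (Prod.ext rfl (Prod.ext rfl ?_)) rfl
  change ∑ j, ((Pi.single i 1 : Fin n → ℝ) j * (Pi.single i 1 : Fin n → ℝ) j - 0 * 0) = 1
  simp [Pi.single_apply]

theorem J₀_e (i : Fin n) : (J₀ n k).1.J (e i) = f i := by
  have h : zCoord (e i : HeisProd n k) = 0 := by
    funext m
    refine Fin.cases rfl (fun _ => rfl) m
  refine Prod.ext (Prod.ext ?_ (Prod.ext rfl ?_)) ?_
  · change -(0 : Fin n → ℝ) = 0
    simp
  · change rot (zCoord (e i)) 0 = 0
    rw [h]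
    simp [rot]
  · change Fin.tail (rot (zCoord (e i))) = 0
    rw [h]
    funext m
    simp [rot, Fin.tail]

theorem zCoord_z (i : Fin (2 * k + 2)) : zCoord (z i : HeisProd n k) = Pi.single i 1 := by
  funext m
  refine Fin.cases ?_ (fun i => ?_) i <;> refine Fin.cases ?_ (fun j => ?_) m
  · rfl
  · simp [zCoord, z]
  · simp [zCoord, z]
  · simp [zCoord, z, Pi.single_apply]

theorem J₀_z (j : Fin (k + 1)) :
    (J₀ n k).1.J (z ⟨2 * j, by omega⟩) = -z ⟨2 * j + 1, by omega⟩ := by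
  have h0 (i : Fin (2 * k + 2)) : (z i : HeisProd n k).1.1 = 0 ∧ (z i : HeisProd n k).1.2.1 = 0 := by
    refine Fin.cases ?_ (fun i => ?_) i <;> exact ⟨rfl, rfl⟩
  have h1 : zCoord (-z ⟨2 * j + 1, by omega⟩ : HeisProd n k) =
      -zCoord (z ⟨2 * j + 1, by omega⟩ : HeisProd n k) := by
    funext m
    refine Fin.cases rfl (fun _ => rfl) m
  have h2 : rot (zCoord (z ⟨2 * j, by omega⟩ : HeisProd n k)) =
      zCoord (-z ⟨2 * j + 1, by omega⟩ : HeisProd n k) := by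
    rw [h1, zCoord_z, zCoord_z]
    funext m
    simp only [rot, Pi.single_apply, Pi.neg_apply, Fin.ext_iff]
    split_ifs <;> first | omega | simp
  refine Prod.ext (Prod.ext ?_ (Prod.ext ?_ (congrFun h2 0))) (funext fun l => congrFun h2 l.succ)
  · change -(z _ : HeisProd n k).1.2.1 = -(z _ : HeisProd n k).1.1
    rw [(h0 _).2, (h0 _).1]
  · change (z _ : HeisProd n k).1.1 = -(z _ : HeisProd n k).1.2.1
    rw [(h0 _).2, (h0 _).1, neg_zero]

end HeisProd

end LieHermitian

/-! Every bracket has the form `[x, y] = ω(x, y) z₀`, where `ω` (`bracketForm`) is the pullback of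
the symplectic form of the plane `ℝ^{2n}`. An abelian complex structure is therefore an endomorphism
`J` with `J² = -1` that leaves `ω` invariant. It preserves the radical of `ω`, which is spanned by
the `z_i`, so it induces a complex structure on the radical and a symplectic one on the plane.

Classification. On the plane, `ω(·, J·)` is a nondegenerate Hermitian form, and diagonalizing it
leaves only its number `p` of negative signs. The radical carries no invariant: complex linear
isomorphisms act transitively on nonzero vectors, so `z₀` can be sent wherever an automorphism
requires. For `n > 0` an automorphism multiplies `ω` by a nonzero scalar, and a negative scalar
exchanges `p` and `n - p`; Sylvester's inertia argument shows that nothing else is identified. The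
classes thus correspond to `0 ≤ p ≤ n / 2` (`exists_standard_equivalent`,
`eq_of_standard_equivalent`), and `p = 0` is the class of `J₀`.

Balanced metrics. Since the derived algebra lies in the line of `z₀`, `d(F^{N-1})` is, up to a
nonzero factor, the contraction with `z₀` of the top-degree form `ω ∧ F^{N-1}`. It vanishes exactly
when that form does, and in a unitary basis diagonalizing `ω(·, J·)` this says that the trace is
zero (`HermitianMetric.isBalanced_iff`). For `p = 0` the form is semidefinite and nonzero, so its
trace never vanishes. For `0 < p < n` both signs occur, and rescaling the metric along the
coordinate planes makes the trace zero. -/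

namespace LieHermitian

/-! ### Complex structures as complex vector spaces -/

section ComplexModule

variable {V : Type*} [AddCommGroup V] [Module ℝ V]

/-- The complex vector space structure defined by an endomorphism `J` with `J² = -1`. -/
noncomputable abbrev complexModule (J : V →ₗ[ℝ] V) (hJ : ∀ x, J (J x) = -x) : Module ℂ V :=
  Module.compHom V (Complex.lift ⟨J, LinearMap.ext hJ⟩ : ℂ →ₐ[ℝ] Module.End ℝ V).toRingHom

theorem complexModule_smul (J : V →ₗ[ℝ] V) (hJ : ∀ x, J (J x) = -x) (c : ℂ) (x : V) :
    (letI := complexModule J hJ; c • x) = c.re • x + c.im • J x := by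
  change (Complex.lift ⟨J, LinearMap.ext hJ⟩ : ℂ →ₐ[ℝ] Module.End ℝ V) c x = _
  simp [Complex.lift, Complex.liftAux_apply]

theorem complexModule_isScalarTower (J : V →ₗ[ℝ] V) (hJ : ∀ x, J (J x) = -x) :
    let := complexModule J hJ
    IsScalarTower ℝ ℂ V := by
  let := complexModule J hJ
  refine ⟨fun r c x => ?_⟩
  rw [complexModule_smul, complexModule_smul]
  simp [smul_add, mul_smul]

theorem complexModule_finite [FiniteDimensional ℝ V] (J : V →ₗ[ℝ] V) (hJ : ∀ x, J (J x) = -x) :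
    let := complexModule J hJ
    FiniteDimensional ℂ V := by
  let := complexModule J hJ
  have := complexModule_isScalarTower J hJ
  exact FiniteDimensional.right ℝ ℂ V

theorem two_mul_finrank_complexModule (J : V →ₗ[ℝ] V) (hJ : ∀ x, J (J x) = -x) :
    let := complexModule J hJ
    2 * Module.finrank ℂ V = Module.finrank ℝ V := by
  let := complexModule J hJ
  have := complexModule_isScalarTower J hJ
  rw [← Complex.finrank_real_complex]
  exact Module.finrank_mul_finrank ℝ ℂ V

/-- Two nonzero vectors of spaces of the same dimension with complex structures correspond under
an isomorphism which commutes with the complex structures. -/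
theorem exists_linearEquiv_conj_apply_eq {V' : Type*} [AddCommGroup V'] [Module ℝ V']
    [FiniteDimensional ℝ V] [FiniteDimensional ℝ V'] (J : V →ₗ[ℝ] V) (J' : V' →ₗ[ℝ] V')
    (hJ : ∀ x, J (J x) = -x) (hJ' : ∀ x, J' (J' x) = -x)
    (hd : Module.finrank ℝ V = Module.finrank ℝ V') {v : V} {v' : V'} (hv : v ≠ 0) (hv' : v' ≠ 0) :
    ∃ ψ : V ≃ₗ[ℝ] V', ψ v = v' ∧ ∀ x, ψ (J x) = J' (ψ x) := by
  let := complexModule J hJ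
  have := complexModule_isScalarTower J hJ
  have := complexModule_finite J hJ
  let := complexModule J' hJ'
  have := complexModule_isScalarTower J' hJ'
  have := complexModule_finite J' hJ'
  have hd' : Module.finrank ℂ V = Module.finrank ℂ V' := by
    have h1 := two_mul_finrank_complexModule J hJ
    have h2 := two_mul_finrank_complexModule J' hJ'
    omega
  let e : V ≃ₗ[ℂ] V' := LinearEquiv.ofFinrankEq V V' hd'
  have hev : e v ≠ 0 := e.map_ne_zero_iff.mpr hv
  -- The isomorphism `ℂ (e v) → ℂ v'` of complex lines extends to an automorphism of `V'`, which
  -- corrects the arbitrary `e`.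
  obtain ⟨ψ, hψ⟩ := Submodule.exists_linearEquiv_restrict_eq
    ((LinearEquiv.toSpanNonzeroSingleton ℂ V' (e v) hev).symm.trans
      (LinearEquiv.toSpanNonzeroSingleton ℂ V' v' hv'))
  have hψv : ψ (e v) = v' := by
    have h1 := hψ (LinearEquiv.toSpanNonzeroSingleton ℂ V' (e v) hev 1)
    rw [LinearEquiv.trans_apply, LinearEquiv.symm_apply_apply] at h1
    simpa using h1.symm
  have hI : ∀ x : V, J x = Complex.I • x := fun x => by
    rw [complexModule_smul]; simp
  have hI' : ∀ x : V', J' x = Complex.I • x := fun x => by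
    rw [complexModule_smul]; simp
  refine ⟨(e.trans ψ).restrictScalars ℝ, hψv, fun x => ?_⟩
  rw [hI, hI']
  exact (e.trans ψ).map_smul _ _

end ComplexModule

/-! ### Unitary diagonalization of Hermitian forms -/

section Diagonalization

variable {V : Type*} [AddCommGroup V] [Module ℝ V] [FiniteDimensional ℝ V]

/-- A Hermitian form can be diagonalized in a unitary basis (stated in real terms). -/
theorem exists_unitary_diagonal (J : V →ₗ[ℝ] V) (hJ : ∀ x, J (J x) = -x)
    (g h : LinearMap.BilinForm ℝ V) (gsymm : ∀ x y, g x y = g y x)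
    (gpos : ∀ x, x ≠ 0 → 0 < g x x) (gJ : ∀ x y, g (J x) (J y) = g x y)
    (hsymm : ∀ x y, h x y = h y x) (hhJ : ∀ x y, h (J x) (J y) = h x y)
    {N : ℕ} (hN : 2 * N = Module.finrank ℝ V) :
    ∃ (u : Fin N → V) (μ : Fin N → ℝ),
      (∀ i j, g (u i) (u j) = if i = j then 1 else 0) ∧ (∀ i j, g (u i) (J (u j)) = 0) ∧
      (∀ i j, h (u i) (u j) = if i = j then μ i else 0) ∧ (∀ i j, h (u i) (J (u j)) = 0) := by
  let := complexModule J hJ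
  have := complexModule_isScalarTower J hJ
  have := complexModule_finite J hJ
  have smul_def : ∀ (c : ℂ) (x : V), c • x = c.re • x + c.im • J x := complexModule_smul J hJ
  have skew : ∀ x y, g (J x) y = -g x (J y) := fun x y => by
    rw [← gJ (J x) y, hJ, map_neg, LinearMap.neg_apply]
  have hskew : ∀ x y, h (J x) y = -h x (J y) := fun x y => by
    rw [← hhJ (J x) y, hJ, map_neg, LinearMap.neg_apply]
  have hnn : ∀ x, 0 ≤ g x x := fun x => by
    rcases eq_or_ne x 0 with rfl | hx
    · simp
    · exact (gpos x hx).le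
  -- The imaginary part is `g (J x) y`, not `g x (J y)`, because the inner product must be
  -- conjugate-linear in its first argument.
  let core : InnerProductSpace.Core ℂ V :=
    { inner := fun x y => ⟨g x y, g (J x) y⟩
      conj_inner_symm := fun x y => by
        apply Complex.ext
        · simp [gsymm y x]
        · simp only [Complex.conj_im]
          rw [skew, gsymm y, neg_neg]
      re_inner_nonneg := fun x => hnn x
      add_left := fun x y z => by
        apply Complex.ext <;> simp
      smul_left := fun x y c => by
        rw [smul_def]
        apply Complex.ext
        · simp [skew]; ring
        · simp [skew, hJ]
      definite := fun x hx => by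
        by_contra h0
        have h1 := gpos x h0
        have h2 := congrArg Complex.re hx
        simp only [Complex.zero_re] at h2
        exact h1.ne' h2 }
  let : NormedAddCommGroup V := core.toNormedAddCommGroup
  let : InnerProductSpace ℂ V := InnerProductSpace.ofCore core.toCore
  have inner_def : ∀ x y : V, inner ℂ x y = (⟨g x y, g (J x) y⟩ : ℂ) := fun _ _ => rfl
  have hnd : g.Nondegenerate := by
    constructor <;> intro x hx <;> by_contra h0 <;> exact (gpos x h0).ne' (hx x)
  have hT : ∀ x y, g ((g.toDual hnd).symm (h x)) y = h x y := fun x y => by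
    rw [LinearMap.BilinForm.apply_toDual_symm_apply]
  -- `T` represents `h` by `g (T x) y = h x y`. Invariance of `h` under `J` makes it complex linear
  -- and symmetry of `h` makes it self-adjoint, so the spectral theorem applies.
  let T : V →ₗ[ℂ] V :=
    { toFun := fun x => (g.toDual hnd).symm (h x)
      map_add' := fun x y => by rw [map_add, map_add]
      map_smul' := fun c x => by
        have hTJ : (g.toDual hnd).symm (h (J x)) = J ((g.toDual hnd).symm (h x)) := by
          apply (g.toDual hnd).injective
          ext y
          rw [LinearEquiv.apply_symm_apply, LinearMap.BilinForm.toDual_def, skew, hT, hskew]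
        rw [smul_def, map_add, map_smul, map_smul, map_add, map_smul, map_smul, hTJ,
          RingHom.id_apply, smul_def] }
  have hTg : ∀ x y, g (T x) y = h x y := hT
  have hTsymm : T.IsSymmetric := fun x y => by
    rw [inner_def, inner_def]
    apply Complex.ext
    · change g (T x) y = g x (T y)
      rw [hTg, gsymm, hTg, hsymm]
    · change g (J (T x)) y = g (J x) (T y)
      rw [skew, hTg, gsymm (J x), hTg, hsymm y, hskew]
  have hr : Module.finrank ℂ V = N := by
    have := two_mul_finrank_complexModule J hJ
    omega
  let u := hTsymm.eigenvectorBasis hr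
  have huu : ∀ i j, inner ℂ (u i) (u j) = if i = j then (1 : ℂ) else 0 :=
    orthonormal_iff_ite.mp u.orthonormal
  have hre : ∀ i j, g (u i) (u j) = if i = j then 1 else 0 := fun i j => by
    have h1 := congrArg Complex.re (huu i j)
    rw [inner_def] at h1
    simp only at h1
    rw [h1]
    split_ifs <;> simp
  have him : ∀ i j, g (u i) (J (u j)) = 0 := fun i j => by
    have h1 := congrArg Complex.im (huu i j)
    rw [inner_def] at h1
    simp only at h1
    rw [skew] at h1
    split_ifs at h1 <;> simpa using h1
  have hTu : ∀ i, T (u i) = hTsymm.eigenvalues hr i • u i := fun i => by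
    have h1 := hTsymm.apply_eigenvectorBasis hr i
    rw [h1, smul_def]
    simp [u]
  refine ⟨u, hTsymm.eigenvalues hr, hre, him, fun i j => ?_, fun i j => ?_⟩
  · rw [← hTg, hTu, map_smul, LinearMap.smul_apply, hre]
    simp
  · rw [← hTg, hTu, map_smul, LinearMap.smul_apply, him]
    simp

end Diagonalization

/-! ### Powers of a 2-form as alternatizations -/

section PowersOfTwoForms

variable {L : Type*} [LieRing L] [LieAlgebra ℝ L]

/-- The multilinear map `∏ F(x_{2i}, x_{2i+1})`, whose alternatization is a multiple of `F^m`. -/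
noncomputable def pairProduct (F : L [⋀^Fin 2]→ₗ[ℝ] ℝ) :
    (m : ℕ) → MultilinearMap ℝ (fun _ : Fin (2 * m) => L) ℝ
  | 0 => (MultilinearMap.constOfIsEmpty ℝ (fun _ : Fin 0 => L) (1 : ℝ) :
      MultilinearMap ℝ (fun _ : Fin 0 => L) ℝ)
  | m + 1 => (((LinearMap.mul' ℝ ℝ).compMultilinearMap
      ((pairProduct F m).domCoprod F.toMultilinearMap)).domDomCongr finSumFinEquiv :
      MultilinearMap ℝ (fun _ : Fin (2 * m + 2) => L) ℝ)

theorem pairProduct_apply (F : L [⋀^Fin 2]→ₗ[ℝ] ℝ) (m : ℕ) (x : Fin (2 * m) → L) :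
    pairProduct F m x =
      ∏ i : Fin m, F ![x ⟨2 * i, by omega⟩, x ⟨2 * i + 1, by omega⟩] := by
  induction m with
  | zero => simp [pairProduct]
  | succ m ih =>
    rw [Fin.prod_univ_castSucc]
    have h1 : pairProduct F (m + 1) x = pairProduct F m (fun i => x (Fin.castAdd 2 i)) *
        F (fun i => x (Fin.natAdd (2 * m) i)) := by
      simp [pairProduct]
    rw [h1, ih]
    congr 1
    congr 1
    funext i
    fin_cases i <;> rfl

theorem alternatization_domDomCongr {ι ι' : Type*} [Fintype ι] [DecidableEq ι] [Fintype ι']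
    [DecidableEq ι'] {M : Type*} [AddCommGroup M] [Module ℝ M]
    (e : ι ≃ ι') (f : MultilinearMap ℝ (fun _ : ι => M) ℝ) :
    MultilinearMap.alternatization (f.domDomCongr e) =
      (MultilinearMap.alternatization f).domDomCongr e := by
  ext v
  rw [AlternatingMap.domDomCongr_apply, MultilinearMap.alternatization_apply,
    MultilinearMap.alternatization_apply]
  refine Fintype.sum_equiv (Equiv.permCongr e.symm) _ _ fun σ => ?_
  rw [Equiv.Perm.sign_permCongr]
  congr 1
  simp only [MultilinearMap.domDomCongr_apply]
  congr 1
  funext i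
  simp

theorem wedge_alternatization {p q : ℕ} (a : MultilinearMap ℝ (fun _ : Fin p => L) ℝ)
    (b : MultilinearMap ℝ (fun _ : Fin q => L) ℝ) :
    wedge (MultilinearMap.alternatization a) (MultilinearMap.alternatization b) =
      MultilinearMap.alternatization (((LinearMap.mul' ℝ ℝ).compMultilinearMap
        (a.domCoprod b)).domDomCongr finSumFinEquiv) := by
  rw [alternatization_domDomCongr, LinearMap.compMultilinearMap_alternatization,
    MultilinearMap.domCoprod_alternization]
  rfl

theorem wedge_smul_smul {p q : ℕ} (c d : ℝ) (a : L [⋀^Fin p]→ₗ[ℝ] ℝ) (b : L [⋀^Fin q]→ₗ[ℝ] ℝ) :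
    wedge (c • a) (d • b) = (c * d) • wedge a b := by
  unfold wedge
  rw [← AlternatingMap.domCoprod'_apply, ← AlternatingMap.domCoprod'_apply,
    ← TensorProduct.smul_tmul', TensorProduct.tmul_smul, map_smul, map_smul, smul_smul]
  ext v
  simp

/-- `wedge` sums over shuffles, so a wedge of alternatizations is the alternatization of the tensor
product. Alternatizing `F`, which is already alternating, gives `2 F`; hence one factor 2 per copy
of `F`. -/
theorem two_pow_smul_wedgePow (F : L [⋀^Fin 2]→ₗ[ℝ] ℝ) (m : ℕ) :
    (2 : ℝ) ^ m • wedgePow F m = MultilinearMap.alternatization (pairProduct F m) := by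
  induction m with
  | zero =>
    ext v
    rw [MultilinearMap.alternatization_apply]
    simp [pairProduct, wedgePow]
  | succ m ih =>
    change (2 : ℝ) ^ (m + 1) • wedge (wedgePow F m) F = _
    have h2 : MultilinearMap.alternatization F.toMultilinearMap = (2 : ℝ) • F := by
      rw [AlternatingMap.coe_alternatization]
      ext v
      simp
    rw [pow_succ, ← wedge_smul_smul, ih, ← h2, wedge_alternatization]
    rfl

end PowersOfTwoForms

/-! ### The value of `F^m` on a standard basis -/

section PairedPermutations

/-- The matrix of a `2`-form in a standard basis. -/
def pairSign (a b : ℕ) : ℤ :=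
  if a / 2 = b / 2 then if a % 2 < b % 2 then 1 else if b % 2 < a % 2 then -1 else 0 else 0

/-- Such a `σ` is a family of permutations inside the pairs followed by a permutation `π` of the
pairs. The latter acts as `π` on two copies of `ι`, hence is even, so only the signs inside the
pairs remain. -/
theorem sign_mul_prod_eq_one_of_preserves_pairs {ι : Type*} [Fintype ι] [DecidableEq ι]
    (σ : Equiv.Perm (ι × Fin 2)) (hσ : ∀ i, (σ (i, 0)).1 = (σ (i, 1)).1) :
    ((Equiv.Perm.sign σ : ℤˣ) : ℤ) *
      ∏ i, (if (σ (i, 0)).2 < (σ (i, 1)).2 then (1 : ℤ) else -1) = 1 := by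
  have hfst : ∀ i s, (σ (i, s)).1 = (σ (i, 0)).1 := fun i s => by
    fin_cases s
    · rfl
    · exact (hσ i).symm
  have hsurj : Function.Surjective fun i => (σ (i, 0)).1 := fun j => by
    obtain ⟨⟨i, s⟩, h⟩ := σ.surjective (j, 0)
    exact ⟨i, by change (σ (i, 0)).1 = j; rw [← hfst i s, h]⟩
  let π : Equiv.Perm ι :=
    Equiv.ofBijective _ ⟨Finite.injective_iff_surjective.mpr hsurj, hsurj⟩
  have hinj : ∀ i, Function.Injective fun s => (σ (i, s)).2 := fun i s t hst => by
    have h1 : σ (i, s) = σ (i, t) := Prod.ext ((hfst i s).trans (hfst i t).symm) hst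
    exact congrArg Prod.snd (σ.injective h1)
  let τ : ι → Equiv.Perm (Fin 2) := fun i =>
    Equiv.ofBijective _ ⟨hinj i, Finite.injective_iff_surjective.mp (hinj i)⟩
  have hdec : σ = (Equiv.prodCongrRight τ).trans (Equiv.prodCongrLeft fun _ => π) := by
    ext1 ⟨i, s⟩
    exact Prod.ext (hfst i s) rfl
  have hτ : ∀ ρ : Equiv.Perm (Fin 2),
      ((Equiv.Perm.sign ρ : ℤˣ) : ℤ) = if ρ 0 < ρ 1 then 1 else -1 := by decide
  have hsign : Equiv.Perm.sign σ = ∏ i, Equiv.Perm.sign (τ i) := by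
    conv_lhs => rw [hdec]
    rw [Equiv.Perm.sign_trans, Equiv.Perm.sign_prodCongrRight, Equiv.Perm.sign_prodCongrLeft]
    simp
  have hprod : ((Equiv.Perm.sign σ : ℤˣ) : ℤ) =
      ∏ i, (if (σ (i, 0)).2 < (σ (i, 1)).2 then (1 : ℤ) else -1) := by
    rw [hsign, Units.coe_prod]
    exact Finset.prod_congr rfl fun i _ => hτ (τ i)
  rw [← hprod]
  exact Int.units_coe_mul_self _

/-- The bijection `(i, s) ↦ 2 i + s`. -/
def finPairEquiv (m : ℕ) : Fin m × Fin 2 ≃ Fin (2 * m) where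
  toFun p := ⟨2 * p.1 + p.2, by omega⟩
  invFun a := (⟨a / 2, by omega⟩, ⟨a % 2, by omega⟩)
  left_inv p := Prod.ext (Fin.ext (by simp; omega)) (Fin.ext (by simp; omega))
  right_inv a := Fin.ext (by simp; omega)

/-- If `σ` separates a pair, a factor vanishes; otherwise the previous lemma, transported to `Fin m
× Fin 2`, gives the value 1. -/
theorem sign_mul_prod_pairSign_nonneg (m : ℕ) (σ : Equiv.Perm (Fin (2 * m))) :
    0 ≤ ((Equiv.Perm.sign σ : ℤˣ) : ℤ) * ∏ i : Fin m,
      pairSign (σ ⟨2 * i, by omega⟩) (σ ⟨2 * i + 1, by omega⟩) := by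
  by_cases h0 : ∃ i : Fin m, pairSign (σ ⟨2 * i, by omega⟩) (σ ⟨2 * i + 1, by omega⟩) = 0
  · obtain ⟨i, hi⟩ := h0
    rw [Finset.prod_eq_zero (Finset.mem_univ i) hi, mul_zero]
  push Not at h0
  let E := finPairEquiv m
  let τ : Equiv.Perm (Fin m × Fin 2) := (E.trans σ).trans E.symm
  have hsign : Equiv.Perm.sign τ = Equiv.Perm.sign σ := Equiv.Perm.sign_permCongr E.symm σ
  have hdiv : ∀ i : Fin m,
      (σ ⟨2 * i, by omega⟩ : ℕ) / 2 = (σ ⟨2 * i + 1, by omega⟩ : ℕ) / 2 := fun i => by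
    by_contra hne
    exact h0 i (by rw [pairSign, if_neg hne])
  have hτ : ∀ i, (τ (i, 0)).1 = (τ (i, 1)).1 := fun i => Fin.ext (hdiv i)
  have h1 := sign_mul_prod_eq_one_of_preserves_pairs τ hτ
  rw [hsign] at h1
  suffices h2 : ∀ i : Fin m, pairSign (σ ⟨2 * i, by omega⟩) (σ ⟨2 * i + 1, by omega⟩) =
      if (τ (i, 0)).2 < (τ (i, 1)).2 then (1 : ℤ) else -1 by
    rw [Finset.prod_congr rfl fun i _ => h2 i, h1]
    exact zero_le_one
  intro i
  have h3 := h0 i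
  have h4 : (τ (i, 0)).2 < (τ (i, 1)).2 ↔
    (σ ⟨2 * i, by omega⟩ : ℕ) % 2 < (σ ⟨2 * i + 1, by omega⟩ : ℕ) % 2 := Iff.rfl
  simp only [pairSign, if_pos (hdiv i), h4] at h3 ⊢
  split_ifs at h3 ⊢ <;> simp_all

/-- The value of `F^m` on a standard basis. -/
noncomputable def pairConst (m : ℕ) : ℝ :=
  (2 ^ m)⁻¹ * ∑ σ : Equiv.Perm (Fin (2 * m)), (((Equiv.Perm.sign σ : ℤˣ) : ℤ) * ∏ i : Fin m,
      pairSign (σ ⟨2 * i, by omega⟩) (σ ⟨2 * i + 1, by omega⟩) : ℤ)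

/-- No term is negative and the identity contributes 1. The constant is in fact `m!`, but only its
sign matters for the balanced condition. -/
theorem pairConst_pos (m : ℕ) : 0 < pairConst m := by
  unfold pairConst
  have h : (0 : ℤ) < ∑ σ : Equiv.Perm (Fin (2 * m)), ((Equiv.Perm.sign σ : ℤˣ) : ℤ) *
      ∏ i : Fin m, pairSign (σ ⟨2 * i, by omega⟩) (σ ⟨2 * i + 1, by omega⟩) := by
    refine Finset.sum_pos' (fun σ _ => sign_mul_prod_pairSign_nonneg m σ)
      ⟨1, Finset.mem_univ _, ?_⟩
    have h1 : ∀ i : Fin m, pairSign (2 * i) (2 * i + 1) = 1 := fun i => by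
      have h2 : 2 * (i : ℕ) / 2 = (2 * i + 1) / 2 := by omega
      have h3 : 2 * (i : ℕ) % 2 < (2 * i + 1) % 2 := by omega
      rw [pairSign, if_pos h2, if_pos h3]
    simp [h1]
  have h' : (0 : ℝ) < ((∑ σ : Equiv.Perm (Fin (2 * m)), ((Equiv.Perm.sign σ : ℤˣ) : ℤ) *
      ∏ i : Fin m, pairSign (σ ⟨2 * i, by omega⟩) (σ ⟨2 * i + 1, by omega⟩) : ℤ) : ℝ) := by
    exact_mod_cast h
  positivity

theorem wedgePow_apply_of_pairSign {L : Type*} [LieRing L] [LieAlgebra ℝ L]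
    (F : L [⋀^Fin 2]→ₗ[ℝ] ℝ) (m : ℕ) (v : Fin (2 * m) → L)
    (hv : ∀ a b : Fin (2 * m), F ![v a, v b] = pairSign a b) :
    wedgePow F m v = pairConst m := by
  have h1 := congrArg (fun f => f v) (two_pow_smul_wedgePow F m)
  simp only [AlternatingMap.smul_apply, MultilinearMap.alternatization_apply,
    MultilinearMap.domDomCongr_apply, pairProduct_apply, hv, smul_eq_mul] at h1
  rw [pairConst, eq_inv_mul_iff_mul_eq₀ (by positivity), h1]
  push_cast
  refine Finset.sum_congr rfl fun σ _ => ?_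
  rw [Units.smul_def, zsmul_eq_mul]

end PairedPermutations

/-! ### The differential as a contraction, and the trace criterion -/

section ContractedBracket

variable {L : Type*} [LieRing L] [LieAlgebra ℝ L]

/-- Twice the exterior product of `ω` and `σ`, up to sign, for a skew form `ω`. -/
noncomputable def pairSum {p : ℕ} (ω : LinearMap.BilinForm ℝ L) (σ : L [⋀^Fin p]→ₗ[ℝ] ℝ) :
    L [⋀^Fin (p + 2)]→ₗ[ℝ] ℝ :=
  AlternatingMap.alternatizeUncurryFin (AlternatingMap.alternatizeUncurryFinLM ∘ₗ
    LinearMap.compr₂ ω (LinearMap.toSpanSingleton ℝ (L [⋀^Fin p]→ₗ[ℝ] ℝ) σ))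

/-- Alternatizing twice meets each pair of slots in both orders, and skewness of `ω` merges them
into a factor 2. The slots `a < b` are encoded as `a = i.castSucc`, `b = j.succ` with `i ≤ j`. -/
theorem pairSum_apply {p : ℕ} (ω : LinearMap.BilinForm ℝ L) (hω : ∀ x y, ω y x = -ω x y)
    (σ : L [⋀^Fin p]→ₗ[ℝ] ℝ) (v : Fin (p + 2) → L) :
    pairSum ω σ v = 2 * ∑ i : Fin (p + 1), ∑ j : Fin (p + 1), if i ≤ j then
      (-1 : ℝ) ^ (i + j : ℕ) * (ω (v i.castSucc) (v j.succ) *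
        σ (j.removeNth (i.castSucc.removeNth v))) else 0 := by
  rw [pairSum, AlternatingMap.alternatizeUncurryFin_alternatizeUncurryFinLM_comp_apply,
    Finset.mul_sum]
  refine Finset.sum_congr rfl fun i _ => ?_
  rw [Finset.mul_sum, ← Finset.sum_filter_add_sum_filter_not Finset.univ (fun j => i ≤ j)]
  have h1 : (Finset.univ.filter fun j => i ≤ j) = Finset.Ici i := by ext; simp
  rw [h1, Finset.sum_eq_zero (s := Finset.univ.filter fun j => ¬ i ≤ j), add_zero]
  · refine Finset.sum_congr rfl fun j hj => ?_
    rw [if_pos (Finset.mem_Ici.mp hj)]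
    simp only [LinearMap.compr₂_apply, LinearMap.toSpanSingleton_apply, AlternatingMap.smul_apply,
      hω (v i.castSucc) (v j.succ), zsmul_eq_mul, smul_eq_mul]
    push_cast
    ring
  · intro j hj
    rw [if_neg (Finset.mem_filter.mp hj).2, mul_zero]

theorem removeNth_succ_cons {α : Type*} {p : ℕ} (i : Fin (p + 1)) (z : α) (x : Fin (p + 1) → α) :
    i.succ.removeNth (Fin.cons z x : Fin (p + 2) → α) = Fin.cons z (i.removeNth x) := by
  funext m
  refine Fin.cases ?_ (fun m => ?_) m <;> simp [Fin.removeNth_apply]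

/-- If `[x, y] = ω(x, y) z`, then `dσ` is a multiple of the contraction of `ω ∧ σ` with `z`. -/
theorem pairSum_cons {p : ℕ} (ω : LinearMap.BilinForm ℝ L) (hω : ∀ x y, ω y x = -ω x y) (z : L)
    (hz : ∀ x, ω z x = 0) (hb : ∀ x y : L, ⁅x, y⁆ = ω x y • z)
    (σ : L [⋀^Fin (p + 1)]→ₗ[ℝ] ℝ) (x : Fin (p + 2) → L) :
    pairSum ω σ (Fin.cons z x : Fin (p + 3) → L) = -2 * ceDiff σ x := by
  rw [pairSum_apply ω hω, Fin.sum_univ_succ, Finset.sum_eq_zero (s := Finset.univ) (fun j _ => by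
    rw [Fin.castSucc_zero, Fin.cons_zero, hz, zero_mul, mul_zero, ite_self]), zero_add]
  -- The pairs containing the slot of `z` are gone, so `z` is now an argument of `σ`, where it plays
  -- the role of the bracket `ω(x, y) z`. The sign is `-1` because `pairSum` weights the slots `a <
  -- b` by `(-1)^(a+b-1)`, `ceDiff` by `(-1)^(a+b)`, and prefixing `z` shifts both slots by one.
  have h2 : ceDiff σ x = - ∑ i : Fin (p + 1), ∑ j : Fin (p + 2), if i.succ ≤ j then
      (-1 : ℝ) ^ (i.succ + j : ℕ) *
        (ω ((Fin.cons z x : Fin (p + 3) → L) i.succ.castSucc)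
            ((Fin.cons z x : Fin (p + 3) → L) j.succ) *
          σ (j.removeNth (i.succ.castSucc.removeNth (Fin.cons z x : Fin (p + 3) → L)))) else 0 := by
    rw [ceDiff, ← Finset.sum_neg_distrib]
    refine Finset.sum_congr rfl fun i _ => ?_
    rw [← Finset.sum_neg_distrib, Fin.sum_univ_succ, Fin.sum_univ_succ (n := p + 1)]
    rw [if_neg (by simp), if_neg (by simp), neg_zero]
    congr 1
    refine Finset.sum_congr rfl fun j _ => ?_
    simp only [Fin.castSucc_lt_succ_iff, Fin.succ_le_succ_iff]
    by_cases hij : i ≤ j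
    · rw [if_pos hij, if_pos hij, hb]
      have h3 : j.succ.removeNth (i.succ.castSucc.removeNth (Fin.cons z x : Fin (p + 3) → L)) =
          Fin.cons z (i.removeNth (j.succ.removeNth x)) := by
        rw [← Fin.succ_castSucc, removeNth_succ_cons, removeNth_succ_cons]
        congr 1
        rw [Fin.removeNth_removeNth_eq_swap]
        simp [Fin.predAbove, not_lt.mpr hij, Fin.succAbove]
      have h4 : (Fin.cons (ω (x i.castSucc) (x j.succ) • z) (i.removeNth (j.succ.removeNth x)) :
          Fin (p + 1) → L) = Function.update (Fin.cons z (i.removeNth (j.succ.removeNth x))) 0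
            (ω (x i.castSucc) (x j.succ) • z) := by
        rw [Fin.update_cons_zero]
      have h5 : (Fin.cons z (i.removeNth (j.succ.removeNth x)) : Fin (p + 1) → L) =
          Function.update (Fin.cons z (i.removeNth (j.succ.removeNth x))) 0 z := by
        rw [Fin.update_cons_zero]
      rw [h3, h4, AlternatingMap.map_update_smul, ← h5, ← Fin.succ_castSucc, Fin.cons_succ,
        Fin.cons_succ, smul_eq_mul]
      simp only [Fin.val_succ]
      ring
    · rw [if_neg hij, if_neg hij, neg_zero]
  rw [h2]
  ring

/-- Only the slot pairs `{2l, 2l+1}` contribute, since `ω` vanishes between different blocks.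
Deleting a block leaves a standard family for `F`, on which `F^M` takes the value `pairConst M`. -/
theorem pairSum_wedgePow_apply {M : ℕ} (ω : LinearMap.BilinForm ℝ L) (hω : ∀ x y, ω y x = -ω x y)
    (F : L [⋀^Fin 2]→ₗ[ℝ] ℝ) (v : Fin (2 * M + 2) → L)
    (hF : ∀ a b : Fin (2 * M + 2), F ![v a, v b] = pairSign a b) (μ : Fin (M + 1) → ℝ)
    (hμ : ∀ l : Fin (M + 1), ω (v ⟨2 * l, by omega⟩) (v ⟨2 * l + 1, by omega⟩) = μ l)
    (h0 : ∀ a b : Fin (2 * M + 2), (a : ℕ) / 2 ≠ b / 2 → ω (v a) (v b) = 0) :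
    pairSum ω (wedgePow F M) v = 2 * pairConst M * ∑ l, μ l := by
  rw [pairSum_apply ω hω, mul_assoc, Finset.mul_sum Finset.univ μ]
  congr 1
  symm
  -- The block `l` is the index pair `i = j = 2l`. For odd `i` the second slot `j + 1 > i` lies in a
  -- later block, so the whole row vanishes.
  refine Fintype.sum_of_injective (fun l : Fin (M + 1) => (⟨2 * l, by omega⟩ : Fin (2 * M + 1)))
    (fun l l' h => Fin.ext (by have := congrArg Fin.val h; simp only at this; omega)) _ _
    (fun i hi => ?_) (fun l => ?_)
  · refine Finset.sum_eq_zero fun j _ => ?_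
    split_ifs with hij
    · rw [h0, zero_mul, mul_zero]
      simp only [Fin.val_castSucc, Fin.val_succ]
      have hij' : (i : ℕ) ≤ j := hij
      have h1 : (i : ℕ) % 2 ≠ 0 := fun h1 =>
        hi ⟨⟨i / 2, by omega⟩, Fin.ext (by simp only; omega)⟩
      omega
    · rfl
  · rw [Finset.sum_eq_single (⟨2 * l, by omega⟩ : Fin (2 * M + 1))]
    · rw [if_pos le_rfl, ← two_mul, pow_mul, neg_one_sq, one_pow, one_mul, mul_comm (pairConst M)]
      congr 1
      · exact (hμ l).symm
      · refine (wedgePow_apply_of_pairSign F M _ fun a b => ?_).symm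
        have hval : ∀ a : Fin (2 * M),
            (((⟨2 * l, by omega⟩ : Fin (2 * M + 1)).castSucc.succAbove
              ((⟨2 * l, by omega⟩ : Fin (2 * M + 1)).succAbove a) : Fin (2 * M + 2)) : ℕ) =
            if (a : ℕ) < 2 * l then (a : ℕ) else a + 2 := fun a => by
          by_cases h : (a : ℕ) < 2 * l
          · simp [Fin.succAbove, Fin.lt_def, h]
          · have h' : ¬ (a : ℕ) + 1 < 2 * l := by omega
            simp [Fin.succAbove, Fin.lt_def, h, h']
        simp only [Fin.removeNth_apply]
        rw [hF, hval, hval]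
        norm_cast
        unfold pairSign
        split_ifs <;> omega
    · intro j _ hj
      split_ifs with hij
      · rw [h0, zero_mul, mul_zero]
        simp only [Fin.val_castSucc, Fin.val_succ]
        have hij' : 2 * (l : ℕ) ≤ j := hij
        have hj' : (j : ℕ) ≠ 2 * l := fun h => hj (Fin.ext h)
        omega
      · rfl
    · simp

/-- If an alternating map of top degree vanishes as soon as one of its arguments is a given nonzero
vector, then it is zero. -/
theorem eq_zero_of_cons_eq_zero {p : ℕ} (Ω : L [⋀^Fin (p + 1)]→ₗ[ℝ] ℝ)
    (b : Module.Basis (Fin (p + 1)) ℝ L) {z : L} (hz : z ≠ 0)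
    (h : ∀ x : Fin p → L, Ω (Fin.cons z x : Fin (p + 1) → L) = 0) : Ω = 0 := by
  obtain ⟨a, ha⟩ : ∃ a, b.repr z a ≠ 0 := by
    by_contra! h0
    exact hz (b.repr.map_eq_zero_iff.mp (Finsupp.ext h0))
  have h1 : Ω (Function.update b a z) = b.repr z a * Ω b := by
    conv_lhs => rw [← b.sum_repr z]
    rw [← AlternatingMap.coe_multilinearMap, MultilinearMap.map_update_sum,
      Finset.sum_eq_single a]
    · rw [MultilinearMap.map_update_smul, Function.update_eq_self, smul_eq_mul]
    · intro c _ hc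
      rw [MultilinearMap.map_update_smul, AlternatingMap.coe_multilinearMap,
        Ω.map_update_self _ hc.symm, smul_zero]
    · simp
  have h2 : Function.update b a z = a.insertNth z (a.removeNth b) := by
    rw [Fin.insertNth_removeNth]
  rw [h2, AlternatingMap.map_insertNth] at h1
  have h3 : Ω (Matrix.vecCons z (a.removeNth b)) = 0 := h _
  rw [h3, smul_zero] at h1
  exact (Ω.map_basis_eq_zero_iff b).mp ((mul_eq_zero.mp h1.symm).resolve_left ha)

/-- The balanced condition when the derived algebra is at most one-dimensional: in a unitary basis
`u_i, J u_i` which diagonalizes `ω(·, J·)` it is the vanishing of the trace. -/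
theorem HermitianMetric.isBalanced_iff {M : ℕ} (hL : Module.finrank ℝ L = 2 * (M + 2))
    {J : ComplexStructure L} (m : HermitianMetric J) (ω : LinearMap.BilinForm ℝ L)
    (hω : ∀ x y, ω y x = -ω x y) {z : L} (hz0 : z ≠ 0) (hz : ∀ x, ω z x = 0)
    (hb : ∀ x y : L, ⁅x, y⁆ = ω x y • z) (hJ : ∀ x y, ω (J.J x) (J.J y) = ω x y)
    {ι : Type*} [Fintype ι] [DecidableEq ι] (hι : Fintype.card ι = M + 2)
    (u : ι → L) (μ : ι → ℝ)
    (hu : ∀ i j, m.g (u i) (u j) = if i = j then 1 else 0)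
    (huJ : ∀ i j, m.g (u i) (J.J (u j)) = 0)
    (hω0 : ∀ i j, ω (u i) (u j) = 0)
    (hμ : ∀ i j, ω (u i) (J.J (u j)) = if i = j then μ i else 0) :
    m.IsBalanced ↔ ∑ i, μ i = 0 := by
  let e : Fin (M + 2) ≃ ι := (Fintype.equivFinOfCardEq hι).symm
  have hd : Module.finrank ℝ L / 2 - 1 = M + 1 := by omega
  have hbal : m.IsBalanced ↔ IsClosedForm (wedgePow m.fundamentalForm (M + 1)) := by
    rw [HermitianMetric.IsBalanced, hd]
  let w : Fin (2 * (M + 1) + 2) → ι := fun a => e ⟨a / 2, by omega⟩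
  -- Within a block `J u` precedes `u`, so that `F(J u, u) = g(J u, J u) = 1`. The price is the sign
  -- in `ω(J u, u) = -μ` below.
  let v : Fin (2 * (M + 1) + 2) → L := fun a => if (a : ℕ) % 2 = 0 then J.J (u (w a)) else u (w a)
  have hw : ∀ a b, w a = w b ↔ (a : ℕ) / 2 = b / 2 := fun a b => by
    simp [w]
  have huJ' : ∀ i j, m.g (J.J (u i)) (u j) = 0 := fun i j => by rw [m.symm, huJ]
  have hF : ∀ a b : Fin (2 * (M + 1) + 2),
      m.fundamentalForm ![v a, v b] = pairSign a b := fun a b => by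
    change m.g (v a) (J.J (v b)) = _
    simp only [v, pairSign]
    by_cases hab : (a : ℕ) / 2 = b / 2
    · rcases Nat.mod_two_eq_zero_or_one a with ha | ha <;>
        rcases Nat.mod_two_eq_zero_or_one b with hb | hb <;>
        simp [ha, hb, J.sq, hu, huJ, huJ', m.compat, hw, hab]
    · rcases Nat.mod_two_eq_zero_or_one a with ha | ha <;>
        rcases Nat.mod_two_eq_zero_or_one b with hb | hb <;>
        simp [ha, hb, J.sq, hu, huJ, huJ', m.compat, hw, hab]
  have hg : ∀ a b, m.g (v a) (v b) = if a = b then 1 else 0 := fun a b => by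
    have hab : a = b ↔ (a : ℕ) / 2 = b / 2 ∧ (a : ℕ) % 2 = b % 2 := by
      rw [Fin.ext_iff]; omega
    simp only [v, hab]
    rcases Nat.mod_two_eq_zero_or_one a with ha | ha <;>
      rcases Nat.mod_two_eq_zero_or_one b with hb | hb <;>
      simp [ha, hb, hu, huJ, huJ', m.compat, hw]
  have hli : LinearIndependent ℝ v := by
    rw [Fintype.linearIndependent_iff]
    intro c hc a
    have h1 := congrArg (m.g (v a)) hc
    simpa [map_sum, hg] using h1
  let b : Module.Basis (Fin (2 * (M + 1) + 2)) ℝ L :=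
    basisOfLinearIndependentOfCardEqFinrank hli (by rw [Fintype.card_fin, hL]; ring)
  have hbv : ⇑b = v := coe_basisOfLinearIndependentOfCardEqFinrank _ _
  have hval : pairSum ω (wedgePow m.fundamentalForm (M + 1)) v =
      2 * pairConst (M + 1) * ∑ l : Fin (M + 2), -μ (e l) := by
    refine pairSum_wedgePow_apply ω hω _ v hF _ (fun l => ?_) (fun a b hab => ?_)
    · have h1 : (2 * (l : ℕ)) % 2 = 0 := by omega
      have h2 : ¬ (2 * (l : ℕ) + 1) % 2 = 0 := by omega
      have h3 : 2 * (l : ℕ) / 2 = l := by omega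
      have h4 : (2 * (l : ℕ) + 1) / 2 = l := by omega
      simp only [v, w, h1, h2, h3, h4, if_true, if_false]
      rw [hω, hμ, if_pos rfl]
    · have hab' : w a ≠ w b := fun h => hab ((hw a b).mp h)
      simp only [v]
      split_ifs
      · rw [hJ, hω0]
      · rw [hω, hμ, if_neg hab'.symm, neg_zero]
      · rw [hμ, if_neg hab']
      · rw [hω0]
  have hsum : ∑ l : Fin (M + 2), -μ (e l) = -∑ i, μ i := by
    rw [Finset.sum_neg_distrib, Equiv.sum_comp e μ]
  rw [hbal]
  have hC := pairConst_pos (M + 1)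
  constructor
  · intro hc
    -- Closedness kills the contraction with `z`; in top degree, `2 (M + 2) = dim L`, this forces
    -- the form itself to vanish.
    have h1 : pairSum ω (wedgePow m.fundamentalForm (M + 1)) = 0 :=
      eq_zero_of_cons_eq_zero _ b hz0 fun x => by
        have h2 := pairSum_cons (p := 2 * M + 1) ω hω z hz hb
          (wedgePow m.fundamentalForm (M + 1)) x
        rw [hc x, mul_zero] at h2
        exact h2
    rw [h1, AlternatingMap.zero_apply, hsum] at hval
    have h3 := (mul_eq_zero.mp hval.symm).resolve_left (by positivity)
    linarith
  · intro h0 x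
    have h1 : pairSum ω (wedgePow m.fundamentalForm (M + 1)) = 0 := by
      rw [← AlternatingMap.map_basis_eq_zero_iff b, hbv, hval, hsum, h0, neg_zero, mul_zero]
    have h2 := pairSum_cons (p := 2 * M + 1) ω hω z hz hb
      (wedgePow m.fundamentalForm (M + 1)) x
    have h3 : pairSum ω (wedgePow m.fundamentalForm (M + 1))
      (Fin.cons z x : Fin (2 * M + 4) → L) = 0 := by rw [h1]; rfl
    have h4 : -2 * ceDiff (p := 2 * M + 2) (wedgePow m.fundamentalForm (M + 1)) x = 0 :=
      h2.symm.trans h3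
    have h5 := (mul_eq_zero.mp h4).resolve_left (by norm_num)
    exact h5

end ContractedBracket
-- Invariant inner products and unitary families
section UnitaryBases

variable {V : Type*} [AddCommGroup V] [Module ℝ V] [FiniteDimensional ℝ V]

/-- Average any inner product over `1` and `J`; since `J² = -1`, applying `J` only exchanges the two
summands. -/
theorem exists_invariant_inner (J : V →ₗ[ℝ] V) (hJ : ∀ x, J (J x) = -x) :
    ∃ g : LinearMap.BilinForm ℝ V, (∀ x y, g x y = g y x) ∧ (∀ x, x ≠ 0 → 0 < g x x) ∧
      ∀ x y, g (J x) (J y) = g x y := by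
  let b := Module.finBasis ℝ V
  let g₀ : LinearMap.BilinForm ℝ V := ∑ i, LinearMap.BilinForm.linMulLin (b.coord i) (b.coord i)
  have hg₀ : ∀ x y, g₀ x y = ∑ i, b.repr x i * b.repr y i := fun x y => by
    simp [g₀, LinearMap.sum_apply]
  have hnn : ∀ x, 0 ≤ g₀ x x := fun x => by
    rw [hg₀]
    exact Finset.sum_nonneg fun i _ => mul_self_nonneg _
  refine ⟨g₀ + g₀.comp J J, fun x y => ?_, fun x hx => ?_, fun x y => ?_⟩
  · simp only [LinearMap.add_apply, LinearMap.BilinForm.comp_apply, hg₀, mul_comm]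
  · have h1 : 0 < g₀ x x := by
      refine lt_of_le_of_ne (hnn x) fun h0 => hx ?_
      rw [hg₀, eq_comm, Finset.sum_eq_zero_iff_of_nonneg fun i _ => mul_self_nonneg _] at h0
      exact b.repr.map_eq_zero_iff.mp
        (Finsupp.ext fun i => mul_self_eq_zero.mp (h0 i (Finset.mem_univ i)))
    have h2 := hnn (J x)
    simp only [LinearMap.add_apply, LinearMap.BilinForm.comp_apply]
    linarith
  · simp only [LinearMap.add_apply, LinearMap.BilinForm.comp_apply, hJ, map_neg,
      LinearMap.neg_apply, neg_neg]
    exact add_comm _ _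

/-- A linear form which vanishes on the vectors of a unitary family of full size is zero. -/
theorem linearForm_eq_zero_of_unitary (J : V →ₗ[ℝ] V)
    (g : LinearMap.BilinForm ℝ V) (gsymm : ∀ x y, g x y = g y x)
    (gJ : ∀ x y, g (J x) (J y) = g x y)
    {N : ℕ} (hN : 2 * N = Module.finrank ℝ V) (u : Fin N → V)
    (hu : ∀ i j, g (u i) (u j) = if i = j then 1 else 0) (huJ : ∀ i j, g (u i) (J (u j)) = 0)
    (f : V →ₗ[ℝ] ℝ) (hf : ∀ i, f (u i) = 0) (hfJ : ∀ i, f (J (u i)) = 0) : f = 0 := by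
  let v : Fin N ⊕ Fin N → V := Sum.elim u fun i => J (u i)
  have hg : ∀ a b, g (v a) (v b) = if a = b then 1 else 0 := by
    rintro (i | i) (j | j) <;> simp [v, hu, huJ, gJ, gsymm (J _) (u _)]
  have hli : LinearIndependent ℝ v := by
    rw [Fintype.linearIndependent_iff]
    intro c hc a
    have h1 := congrArg (g (v a)) hc
    simpa only [map_sum, map_smul, hg, smul_eq_mul, mul_ite, mul_one, mul_zero,
      Finset.sum_ite_eq, Finset.mem_univ, if_true, map_zero] using h1
  let b : Module.Basis (Fin N ⊕ Fin N) ℝ V :=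
    basisOfLinearIndependentOfCardEqFinrank' v hli (by simp; omega)
  refine b.ext fun a => ?_
  rcases a with i | i <;> simp [b, v, hf, hfJ]

end UnitaryBases

/-! ### Coordinates and the bracket form -/

namespace HeisProd

variable {n k : ℕ}

/-- The coordinates along the `e_i` and `f_i`. -/
def toPlane : HeisProd n k →ₗ[ℝ] (Fin n → ℝ) × (Fin n → ℝ) where
  toFun u := (u.1.1, u.1.2.1)
  map_add' _ _ := rfl
  map_smul' _ _ := rfl

/-- The coordinates along the `z_i`. -/
def toCenter : HeisProd n k →ₗ[ℝ] (Fin (2 * k + 2) → ℝ) where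
  toFun u := zCoord u
  map_add' _ _ := by
    funext m
    refine Fin.cases rfl (fun _ => rfl) m
  map_smul' _ _ := by
    funext m
    refine Fin.cases rfl (fun _ => rfl) m

/-- The inclusion of the span of the `e_i` and `f_i`. -/
noncomputable def ofPlane : (Fin n → ℝ) × (Fin n → ℝ) →ₗ[ℝ] HeisProd n k where
  toFun x := (((x.1, x.2, 0) : (Fin n → ℝ) × (Fin n → ℝ) × ℝ), (0 : Fin (2 * k + 1) → ℝ))
  map_add' _ _ := Prod.ext (Prod.ext rfl (Prod.ext rfl (add_zero 0).symm)) (add_zero 0).symm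
  map_smul' c _ := Prod.ext (Prod.ext rfl (Prod.ext rfl (smul_zero c).symm))
    (smul_zero (A := Fin (2 * k + 1) → ℝ) c).symm

/-- The inclusion of the span of the `z_i`. -/
noncomputable def ofCenter : (Fin (2 * k + 2) → ℝ) →ₗ[ℝ] HeisProd n k where
  toFun c := (((0, 0, c 0) : (Fin n → ℝ) × (Fin n → ℝ) × ℝ), (Fin.tail c : Fin (2 * k + 1) → ℝ))
  map_add' _ _ := Prod.ext (Prod.ext (add_zero 0).symm (Prod.ext (add_zero 0).symm rfl)) rfl
  map_smul' c _ := Prod.ext (Prod.ext (smul_zero c).symm (Prod.ext (smul_zero c).symm rfl)) rfl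

@[simp] theorem toPlane_ofPlane (x : (Fin n → ℝ) × (Fin n → ℝ)) :
    toPlane (ofPlane x : HeisProd n k) = x := rfl

@[simp] theorem toPlane_ofCenter (c : Fin (2 * k + 2) → ℝ) :
    toPlane (ofCenter c : HeisProd n k) = 0 := rfl

@[simp] theorem toCenter_ofPlane (x : (Fin n → ℝ) × (Fin n → ℝ)) :
    toCenter (ofPlane x : HeisProd n k) = 0 := by
  funext m
  refine Fin.cases rfl (fun _ => rfl) m

@[simp] theorem toCenter_ofCenter (c : Fin (2 * k + 2) → ℝ) :
    toCenter (ofCenter c : HeisProd n k) = c := by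
  funext m
  refine Fin.cases rfl (fun _ => rfl) m

theorem ext_coords {u v : HeisProd n k} (h : toPlane u = toPlane v)
    (h' : toCenter u = toCenter v) : u = v :=
  Prod.ext (Prod.ext (congrArg Prod.fst h : (toPlane u).1 = (toPlane v).1)
    (Prod.ext (congrArg Prod.snd h : (toPlane u).2 = (toPlane v).2) (congrFun h' 0)))
    (funext fun l => congrFun h' l.succ)

theorem ofPlane_add_ofCenter (u : HeisProd n k) :
    ofPlane (toPlane u) + ofCenter (toCenter u) = u :=
  ext_coords (by simp) (by simp)

variable (n k) in
/-- The coordinates of an element. -/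
noncomputable def coordEquiv :
    HeisProd n k ≃ₗ[ℝ] ((Fin n → ℝ) × (Fin n → ℝ)) × (Fin (2 * k + 2) → ℝ) where
  __ := toPlane.prod toCenter
  invFun p := ofPlane p.1 + ofCenter p.2
  left_inv u := ofPlane_add_ofCenter u
  right_inv p := Prod.ext (by simp) (by simp)

instance : FiniteDimensional ℝ (HeisProd n k) := (coordEquiv n k).symm.finiteDimensional

theorem finrank_plane : Module.finrank ℝ ((Fin n → ℝ) × (Fin n → ℝ)) = 2 * n := by
  simp [two_mul]

theorem finrank_eq : Module.finrank ℝ (HeisProd n k) = 2 * (n + k + 1) := by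
  rw [(coordEquiv n k).finrank_eq, Module.finrank_prod, finrank_plane]
  simp
  ring

variable (n) in
/-- The standard symplectic form. -/
noncomputable def symplectic : LinearMap.BilinForm ℝ ((Fin n → ℝ) × (Fin n → ℝ)) :=
  LinearMap.mk₂ ℝ (fun x y => ∑ i, (x.1 i * y.2 i - x.2 i * y.1 i))
    (fun x x' y => by
      rw [← Finset.sum_add_distrib]
      exact Finset.sum_congr rfl fun i _ => by
        simp only [Prod.fst_add, Prod.snd_add, Pi.add_apply]; ring)
    (fun c x y => by
      rw [smul_eq_mul, Finset.mul_sum]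
      exact Finset.sum_congr rfl fun i _ => by
        simp only [Prod.smul_fst, Prod.smul_snd, Pi.smul_apply, smul_eq_mul]; ring)
    (fun x y y' => by
      rw [← Finset.sum_add_distrib]
      exact Finset.sum_congr rfl fun i _ => by
        simp only [Prod.fst_add, Prod.snd_add, Pi.add_apply]; ring)
    (fun c x y => by
      rw [smul_eq_mul, Finset.mul_sum]
      exact Finset.sum_congr rfl fun i _ => by
        simp only [Prod.smul_fst, Prod.smul_snd, Pi.smul_apply, smul_eq_mul]; ring)

theorem symplectic_apply (x y : (Fin n → ℝ) × (Fin n → ℝ)) :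
    symplectic n x y = ∑ i, (x.1 i * y.2 i - x.2 i * y.1 i) := rfl

theorem symplectic_swap (x y : (Fin n → ℝ) × (Fin n → ℝ)) :
    symplectic n y x = -symplectic n x y := by
  rw [symplectic_apply, symplectic_apply, ← Finset.sum_neg_distrib]
  exact Finset.sum_congr rfl fun i _ => by ring

theorem eq_zero_of_symplectic {x : (Fin n → ℝ) × (Fin n → ℝ)} (h : ∀ y, symplectic n x y = 0) :
    x = 0 := by
  refine Prod.ext (funext fun i => ?_) (funext fun i => ?_)
  · simpa [symplectic_apply, Pi.single_apply] using h (0, Pi.single i 1)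
  · simpa [symplectic_apply, Pi.single_apply] using h (Pi.single i 1, 0)

variable (n k) in
/-- The bilinear form `ω` with `[u, v] = ω(u, v) z₀`. -/
noncomputable def bracketForm : LinearMap.BilinForm ℝ (HeisProd n k) :=
  (symplectic n).comp toPlane toPlane

theorem bracketForm_apply (u v : HeisProd n k) :
    bracketForm n k u v = symplectic n (toPlane u) (toPlane v) := rfl

theorem bracketForm_swap (u v : HeisProd n k) : bracketForm n k v u = -bracketForm n k u v :=
  symplectic_swap _ _

theorem z_zero_eq : (z 0 : HeisProd n k) = ofCenter (Pi.single 0 1) :=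
  ext_coords rfl ((zCoord_z 0).trans (toCenter_ofCenter _).symm)

theorem z_zero_ne : (z 0 : HeisProd n k) ≠ 0 := fun h => by
  have h1 := congrFun (congrArg toCenter h) 0
  rw [z_zero_eq, toCenter_ofCenter, map_zero] at h1
  simp at h1

theorem bracketForm_z_zero (u : HeisProd n k) : bracketForm n k (z 0) u = 0 := by
  rw [bracketForm_apply, z_zero_eq, toPlane_ofCenter, map_zero, LinearMap.zero_apply]

theorem lie_eq (u v : HeisProd n k) : ⁅u, v⁆ = bracketForm n k u v • z 0 := by
  refine ext_coords ?_ ?_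
  · rw [map_smul, z_zero_eq, toPlane_ofCenter, smul_zero]
    rfl
  · rw [map_smul, z_zero_eq, toCenter_ofCenter]
    funext m
    refine Fin.cases ?_ (fun m => ?_) m
    · simp
      rfl
    · simp
      rfl

theorem bracketForm_J (J : AbelianComplexStructure (HeisProd n k)) (u v : HeisProd n k) :
    bracketForm n k (J.1.J u) (J.1.J v) = bracketForm n k u v := by
  have h := J.2 u v
  rw [lie_eq, lie_eq] at h
  exact smul_left_injective ℝ z_zero_ne h

/-- An endomorphism with square `-1` which preserves the bracket is an abelian complex
structure. -/
noncomputable def abelianOfForm (A : HeisProd n k →ₗ[ℝ] HeisProd n k) (hA : ∀ u, A (A u) = -u)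
    (hω : ∀ u v, bracketForm n k (A u) (A v) = bracketForm n k u v) :
    AbelianComplexStructure (HeisProd n k) :=
  have hlie : ∀ u v, ⁅A u, A v⁆ = ⁅u, v⁆ := fun u v => by rw [lie_eq, lie_eq, hω]
  ⟨{ J := A
     sq := hA
     nijenhuis := fun X Y => by
      have h : ⁅A X, Y⁆ = -⁅X, A Y⁆ := by
        rw [← hlie (A X) Y, hA, neg_lie]
      rw [h, hlie, map_neg]
      abel }, hlie⟩

variable (k) in
/-- The linear map `rot`. -/
def rotMap : (Fin (2 * k + 2) → ℝ) →ₗ[ℝ] (Fin (2 * k + 2) → ℝ) where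
  toFun := rot
  map_add' c d := by
    funext m
    by_cases h : (m : ℕ) % 2 = 0
    · simp [rot, h]
    · simp [rot, h]; ring
  map_smul' c d := by
    funext m
    by_cases h : (m : ℕ) % 2 = 0 <;> simp [rot, h]

theorem rotMap_rotMap (c : Fin (2 * k + 2) → ℝ) : rotMap k (rotMap k c) = -c := rot_rot c

/-! ### The standard structures -/

/-- The signs `-1` (`p` times), `1` (`n - p` times). -/
def sgn (p i : ℕ) : ℝ := if i < p then -1 else 1

theorem sgn_mul_self (p i : ℕ) : sgn p i * sgn p i = 1 := by
  unfold sgn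
  split_ifs <;> norm_num

variable (n) in
/-- The complex structure `e_i ↦ ε_i f_i` on the symplectic vector space. -/
noncomputable def planeMap (p : ℕ) :
    (Fin n → ℝ) × (Fin n → ℝ) →ₗ[ℝ] (Fin n → ℝ) × (Fin n → ℝ) where
  toFun x := (fun i : Fin n => -(sgn p i * x.2 i), fun i : Fin n => sgn p i * x.1 i)
  map_add' x y := by
    refine Prod.ext (funext fun i => ?_) (funext fun i => ?_) <;> simp <;> ring
  map_smul' c x := by
    refine Prod.ext (funext fun i => ?_) (funext fun i => ?_) <;> simp <;> ring

theorem planeMap_apply (p : ℕ) (x : (Fin n → ℝ) × (Fin n → ℝ)) :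
    planeMap n p x = (fun i : Fin n => -(sgn p i * x.2 i), fun i : Fin n => sgn p i * x.1 i) := rfl

theorem planeMap_planeMap (p : ℕ) (x : (Fin n → ℝ) × (Fin n → ℝ)) :
    planeMap n p (planeMap n p x) = -x := by
  refine Prod.ext (funext fun i => ?_) (funext fun i => ?_)
  · simp [planeMap_apply, ← mul_assoc, sgn_mul_self]
  · simp [planeMap_apply, ← mul_assoc, sgn_mul_self]

theorem symplectic_planeMap (p : ℕ) (x y : (Fin n → ℝ) × (Fin n → ℝ)) :
    symplectic n (planeMap n p x) (planeMap n p y) = symplectic n x y := by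
  rw [symplectic_apply, symplectic_apply]
  refine Finset.sum_congr rfl fun i _ => ?_
  simp only [planeMap_apply]
  linear_combination (x.1 i * y.2 i - x.2 i * y.1 i) * sgn_mul_self p i

theorem symplectic_planeMap_self (p : ℕ) (x : (Fin n → ℝ) × (Fin n → ℝ)) :
    symplectic n x (planeMap n p x) = ∑ i : Fin n, sgn p i * (x.1 i ^ 2 + x.2 i ^ 2) := by
  rw [symplectic_apply]
  refine Finset.sum_congr rfl fun i _ => ?_
  simp only [planeMap_apply]
  ring

variable (n k) in
/-- The abelian complex structure with `J e_i = -f_i` for `i < p` and `J e_i = f_i` for `p ≤ i`,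
equal to `J₀` on the `z_i`. -/
noncomputable def standard (p : ℕ) : AbelianComplexStructure (HeisProd n k) :=
  abelianOfForm (ofPlane ∘ₗ planeMap n p ∘ₗ toPlane + ofCenter ∘ₗ rotMap k ∘ₗ toCenter)
    (fun u => ext_coords (by simp [planeMap_planeMap]) (by simp [rotMap_rotMap]))
    (fun u v => by simp [bracketForm_apply, symplectic_planeMap])

theorem toPlane_standard (p : ℕ) (u : HeisProd n k) :
    toPlane ((standard n k p).1.J u) = planeMap n p (toPlane u) := by
  simp [standard, abelianOfForm]

theorem toCenter_standard (p : ℕ) (u : HeisProd n k) :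
    toCenter ((standard n k p).1.J u) = rotMap k (toCenter u) := by
  simp [standard, abelianOfForm]

theorem standard_zero : standard n k 0 = J₀ n k := by
  have h : (standard n k 0).1.J = (J₀ n k).1.J := by
    refine LinearMap.ext fun u => ext_coords ?_ ?_
    · rw [toPlane_standard, planeMap_apply]
      simp only [sgn, Nat.not_lt_zero, if_false, one_mul]
      rfl
    · rw [toCenter_standard]
      funext m
      refine Fin.cases rfl (fun _ => rfl) m
  apply Subtype.ext
  generalize (standard n k 0).1 = a at h
  generalize (J₀ n k).1 = b at h
  cases a
  cases b
  congr

end HeisProd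
-- Reduction to a standard structure
theorem exists_perm_lt_iff {n : ℕ} (P : Fin n → Prop) [DecidablePred P] :
    ∃ π : Equiv.Perm (Fin n), ∀ i, P (π i) ↔ (i : ℕ) < (Finset.univ.filter P).card := by
  have hcard : (Finset.univ.filter fun i : Fin n => (i : ℕ) < (Finset.univ.filter P).card).card =
      (Finset.univ.filter P).card := by
    rw [Fin.card_filter_val_lt]
    exact min_eq_right ((Finset.card_le_univ _).trans_eq (Fintype.card_fin n))
  have h2 : Fintype.card {i : Fin n // (i : ℕ) < (Finset.univ.filter P).card} =
      Fintype.card {i // P i} := by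
    rw [Fintype.card_subtype, Fintype.card_subtype, hcard]
  let e := Fintype.equivOfCardEq h2
  refine ⟨e.extendSubtype, fun i => ⟨fun h => ?_, fun h => e.extendSubtype_mem i h⟩⟩
  by_contra h'
  exact e.extendSubtype_not_mem i h' h

namespace HeisProd

variable {n k : ℕ}

/-- The kernel of `toPlane` is the radical of `bracketForm`, and `ω(J u, y) = -ω(u, J y)`. -/
theorem toPlane_J_eq_zero (J : AbelianComplexStructure (HeisProd n k)) {u : HeisProd n k}
    (hu : toPlane u = 0) : toPlane (J.1.J u) = 0 := by
  refine eq_zero_of_symplectic fun y => ?_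
  have h1 := bracketForm_J J u (-J.1.J (ofPlane y))
  rw [map_neg, J.1.sq, neg_neg] at h1
  rw [bracketForm_apply, bracketForm_apply, hu, map_zero, LinearMap.zero_apply,
    toPlane_ofPlane] at h1
  exact h1

/-- A linear map which multiplies the bracket form by `δ`, maps `z₀` to `δ z₀` and is injective on
the centre is an automorphism. -/
theorem exists_lieEquiv (φ : HeisProd n k →ₗ[ℝ] HeisProd n k) {δ : ℝ} (hδ : δ ≠ 0)
    (hφ : ∀ u v, bracketForm n k (φ u) (φ v) = δ * bracketForm n k u v)
    (hz : φ (z 0) = δ • z 0) (hc : ∀ c, φ (ofCenter c) = 0 → c = 0) :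
    ∃ Φ : HeisProd n k ≃ₗ⁅ℝ⁆ HeisProd n k, ∀ u, Φ u = φ u := by
  have hinj : Function.Injective φ := by
    rw [← LinearMap.ker_eq_bot, LinearMap.ker_eq_bot']
    intro u hu
    have h1 : toPlane u = 0 := eq_zero_of_symplectic fun y => by
      have h2 := hφ u (ofPlane y)
      rw [hu, map_zero, LinearMap.zero_apply] at h2
      exact (mul_eq_zero.mp h2.symm).resolve_left hδ
    have h3 := ofPlane_add_ofCenter u
    rw [h1, map_zero, zero_add] at h3
    rw [← h3, hc (toCenter u) (by rw [h3, hu]), map_zero]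
  let f : HeisProd n k →ₗ⁅ℝ⁆ HeisProd n k :=
    { φ with
      map_lie' := fun {u v} => by
        change φ ⁅u, v⁆ = ⁅φ u, φ v⁆
        rw [lie_eq, lie_eq, map_smul, hz, hφ, smul_smul, mul_comm δ] }
  exact ⟨LieEquiv.ofBijective f ⟨hinj, LinearMap.injective_iff_surjective.mp hinj⟩, fun u => rfl⟩

/-- Diagonalize `ω(·, A·)` with respect to an auxiliary invariant inner product. A zero entry `μ i`
would put `u i` in the radical of the symplectic form. -/
theorem exists_symplectic_frame (A : (Fin n → ℝ) × (Fin n → ℝ) →ₗ[ℝ] (Fin n → ℝ) × (Fin n → ℝ))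
    (hA : ∀ x, A (A x) = -x) (hAω : ∀ x y, symplectic n (A x) (A y) = symplectic n x y) :
    ∃ (u : Fin n → (Fin n → ℝ) × (Fin n → ℝ)) (μ : Fin n → ℝ), (∀ i, μ i ≠ 0) ∧
      (∀ i j, symplectic n (u i) (u j) = 0) ∧
      ∀ i j, symplectic n (u i) (A (u j)) = if i = j then μ i else 0 := by
  obtain ⟨g, gsymm, gpos, gA⟩ := exists_invariant_inner A hA
  let h : LinearMap.BilinForm ℝ ((Fin n → ℝ) × (Fin n → ℝ)) := (symplectic n).compRight A
  have hh : ∀ x y, h x y = symplectic n x (A y) := fun _ _ => rfl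
  obtain ⟨u, μ, hu, huA, hμ, hμA⟩ := exists_unitary_diagonal A hA g h gsymm gpos gA
    (fun x y => by rw [hh, hh, ← hAω, hA, map_neg, ← symplectic_swap])
    (fun x y => by rw [hh, hh, hAω]) finrank_plane.symm
  have h0 : ∀ i j, symplectic n (u i) (u j) = 0 := fun i j => by
    have h1 := hμA i j
    rwa [hh, hA, map_neg, neg_eq_zero] at h1
  refine ⟨u, μ, fun i hi => ?_, h0, hμ⟩
  have h1 : symplectic n (u i) = 0 :=
    linearForm_eq_zero_of_unitary A g gsymm gA finrank_plane.symm u hu huA _ (h0 i) fun j => by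
      have h2 := hμ i j
      rw [hh] at h2
      rw [h2]
      split_ifs <;> [exact hi; rfl]
  have h2 : u i = 0 := eq_zero_of_symplectic fun y => by rw [h1]; rfl
  have h3 := hu i i
  rw [h2, map_zero, if_pos rfl] at h3
  exact zero_ne_one h3

/-- The linear map which sends the standard symplectic basis to given vectors. -/
noncomputable def frameMap {W : Type*} [AddCommGroup W] [Module ℝ W] (a b : Fin n → W) :
    (Fin n → ℝ) × (Fin n → ℝ) →ₗ[ℝ] W :=
  (Fintype.linearCombination ℝ a).coprod (Fintype.linearCombination ℝ b)

theorem frameMap_apply {W : Type*} [AddCommGroup W] [Module ℝ W] (a b : Fin n → W)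
    (x : (Fin n → ℝ) × (Fin n → ℝ)) :
    frameMap a b x = ∑ i, (x.1 i • a i + x.2 i • b i) := by
  simp [frameMap, Fintype.linearCombination_apply, Finset.sum_add_distrib]

theorem frameMap_symplectic {W : Type*} [AddCommGroup W] [Module ℝ W] (ω : LinearMap.BilinForm ℝ W)
    (hω : ∀ x y, ω y x = -ω x y) (a b : Fin n → W) {δ : ℝ} (haa : ∀ i j, ω (a i) (a j) = 0)
    (hbb : ∀ i j, ω (b i) (b j) = 0) (hab : ∀ i j, ω (a i) (b j) = if i = j then δ else 0)
    (x y : (Fin n → ℝ) × (Fin n → ℝ)) :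
    ω (frameMap a b x) (frameMap a b y) = δ * symplectic n x y := by
  have ha : ∀ i, ω (a i) (frameMap a b y) = δ * y.2 i := fun i => by
    simp [frameMap_apply, haa, hab, mul_comm]
  have hb : ∀ i, ω (b i) (frameMap a b y) = -(δ * y.1 i) := fun i => by
    simp [frameMap_apply, hbb, hω (a _) (b _), hab, mul_comm]
  rw [symplectic_apply, Finset.mul_sum, frameMap_apply a b x, map_sum, LinearMap.sum_apply]
  refine Finset.sum_congr rfl fun i _ => ?_
  rw [map_add, LinearMap.add_apply, map_smul, map_smul, LinearMap.smul_apply,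
    LinearMap.smul_apply, ha, hb, smul_eq_mul, smul_eq_mul]
  ring

/-- Every abelian complex structure is equivalent to a standard one. -/
theorem exists_standard_equivalent (J : AbelianComplexStructure (HeisProd n k)) :
    ∃ p ≤ n / 2, (standard n k p).1.Equivalent J.1 := by
  let A := toPlane ∘ₗ J.1.J ∘ₗ ofPlane
  have hAp : ∀ u, toPlane (J.1.J u) = A (toPlane u) := fun u => by
    conv_lhs => rw [← ofPlane_add_ofCenter u]
    rw [map_add, map_add, toPlane_J_eq_zero J (toPlane_ofCenter _), add_zero]
    rfl
  have hA : ∀ x, A (A x) = -x := fun x => by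
    have h1 := hAp (J.1.J (ofPlane x))
    rw [J.1.sq, hAp, map_neg, toPlane_ofPlane] at h1
    exact h1.symm
  have hAω : ∀ x y, symplectic n (A x) (A y) = symplectic n x y := fun x y =>
    bracketForm_J J (ofPlane x) (ofPlane y)
  let B := toCenter ∘ₗ J.1.J ∘ₗ ofCenter
  have hBp : ∀ c, J.1.J (ofCenter c) = ofCenter (B c) := fun c =>
    ext_coords (by rw [toPlane_J_eq_zero J (toPlane_ofCenter _), toPlane_ofCenter])
      (by rw [toCenter_ofCenter]; rfl)
  have hB : ∀ c, B (B c) = -c := fun c => by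
    have h1 := congrArg toCenter (J.1.sq (ofCenter c))
    rw [hBp, hBp, toCenter_ofCenter, map_neg, toCenter_ofCenter] at h1
    exact h1
  obtain ⟨u, μ, hμ0, h0, hμ⟩ := exists_symplectic_frame A hA hAω
  -- Replacing `ω` by `-ω` exchanges positive and negative entries, so a sign `δ` can be chosen for
  -- which at most half of them are negative.
  obtain ⟨δ, hδ, hp⟩ : ∃ δ : ℝ, δ * δ = 1 ∧
      (Finset.univ.filter fun i => δ * μ i < 0).card ≤ n / 2 := by
    by_cases hle : (Finset.univ.filter fun i => 1 * μ i < 0).card ≤ n / 2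
    · exact ⟨1, one_mul 1, hle⟩
    · refine ⟨-1, by norm_num, ?_⟩
      have h1 := Finset.card_filter_add_card_filter_not (s := (Finset.univ : Finset (Fin n)))
        (fun i => 1 * μ i < 0)
      have h2 : (Finset.univ.filter fun i => -1 * μ i < 0).card ≤
          (Finset.univ.filter fun i => ¬ 1 * μ i < 0).card :=
        Finset.card_le_card fun i hi => by
          simp only [Finset.mem_filter, Finset.mem_univ, true_and] at hi ⊢
          linarith
      rw [Finset.card_univ, Fintype.card_fin] at h1
      omega
  have hδ0 : δ ≠ 0 := fun h => by rw [h] at hδ; norm_num at hδ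
  obtain ⟨π, hπ⟩ := exists_perm_lt_iff fun i => δ * μ i < 0
  generalize (Finset.univ.filter fun i => δ * μ i < 0).card = p at hp hπ
  refine ⟨p, hp, ?_⟩
  -- Normalization: with this factor `ω(a i, J (a i)) = sgn p i * δ` for the vectors `a i` below.
  let r : Fin n → ℝ := fun i => (√|μ (π i)|)⁻¹
  have hr : ∀ i : Fin n, r i * r i * μ (π i) = sgn p i * δ := fun i => by
    have h1 : r i * r i = |μ (π i)|⁻¹ := by
      rw [← mul_inv, Real.mul_self_sqrt (abs_nonneg _)]
    have h2 : sgn p i * |δ * μ (π i)| = δ * μ (π i) := by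
      unfold sgn
      split_ifs with h
      · rw [abs_of_neg ((hπ i).mpr h)]; ring
      · rw [abs_of_nonneg (not_lt.mp fun h' => h ((hπ i).mp h')), one_mul]
    have h3 : |δ| = 1 := by
      rcases mul_self_eq_one_iff.mp hδ with h | h <;> rw [h] <;> norm_num
    have h4 : |μ (π i)| ≠ 0 := abs_ne_zero.mpr (hμ0 _)
    rw [abs_mul, h3, one_mul] at h2
    rw [h1, inv_mul_eq_iff_eq_mul₀ h4]
    linear_combination (-δ) * h2 - μ (π i) * hδ
  have hv : (Pi.single 0 1 : Fin (2 * k + 2) → ℝ) ≠ 0 := by simp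
  -- The map to be built multiplies `ω` by `δ`, so on the centre it must send `z₀` to `δ z₀`;
  -- transitivity on nonzero vectors permits this.
  obtain ⟨ψ, hψ0, hψ⟩ := exists_linearEquiv_conj_apply_eq (rotMap k) B rotMap_rotMap hB rfl hv
    (smul_ne_zero hδ0 hv)
  let a : Fin n → HeisProd n k := fun i => ofPlane (r i • u (π i))
  -- The factor `sgn p i` gives `ω(a i, b i) = δ` for every `i` and matches `e_i ↦ sgn p i • f_i` in
  -- the standard structure.
  let b : Fin n → HeisProd n k := fun i => sgn p i • J.1.J (a i)
  have haa : ∀ i j, bracketForm n k (a i) (a j) = 0 := fun i j => by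
    simp [a, bracketForm_apply, h0]
  have hbb : ∀ i j, bracketForm n k (b i) (b j) = 0 := fun i j => by
    simp only [b, map_smul, LinearMap.smul_apply, bracketForm_J, haa, smul_zero]
  have hab : ∀ i j, bracketForm n k (a i) (b j) = if i = j then δ else 0 := fun i j => by
    simp only [b, a, bracketForm_apply, map_smul, LinearMap.smul_apply, hAp, toPlane_ofPlane, hμ,
      EmbeddingLike.apply_eq_iff_eq, smul_eq_mul]
    split_ifs with hij
    · subst hij
      linear_combination sgn p i * hr i + δ * sgn_mul_self p i
    · simp
  let φ : HeisProd n k →ₗ[ℝ] HeisProd n k :=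
    frameMap a b ∘ₗ toPlane + ofCenter ∘ₗ ψ.toLinearMap ∘ₗ toCenter
  have hφ : ∀ u, φ u = frameMap a b (toPlane u) + ofCenter (ψ (toCenter u)) := fun _ => rfl
  obtain ⟨Φ, hΦ⟩ := exists_lieEquiv φ hδ0
    (fun u v => by
      have h1 : ∀ x y : HeisProd n k, ∀ c d, bracketForm n k (x + ofCenter c) (y + ofCenter d) =
          bracketForm n k x y := fun x y c d => by
        simp [bracketForm_apply]
      rw [hφ, hφ, h1, frameMap_symplectic _ bracketForm_swap a b haa hbb hab]
      rfl)
    (by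
      rw [hφ, z_zero_eq, toPlane_ofCenter, map_zero, zero_add, toCenter_ofCenter, hψ0, map_smul])
    (fun c hc => by
      rw [hφ, toPlane_ofCenter, map_zero, zero_add, toCenter_ofCenter] at hc
      have h1 := congrArg toCenter hc
      rw [toCenter_ofCenter, map_zero] at h1
      exact ψ.map_eq_zero_iff.mp h1)
  refine ⟨Φ, fun w => ?_⟩
  rw [hΦ, hΦ, hφ, hφ, toPlane_standard, toCenter_standard, hψ, map_add, hBp]
  congr 1
  rw [frameMap_apply, frameMap_apply, map_sum]
  refine Finset.sum_congr rfl fun i _ => ?_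
  simp only [planeMap_apply, map_add, map_smul, b, J.1.sq, smul_smul]
  rw [add_comm]
  congr 1
  · rw [mul_right_comm, sgn_mul_self, one_mul]
  · rw [smul_neg, neg_smul, mul_comm (sgn p i)]

/-! ### Invariance of the signature up to sign -/

theorem bracketForm_single (i : Fin n) :
    bracketForm n k (ofPlane (Pi.single i 1, 0)) (ofPlane (0, Pi.single i 1)) = 1 := by
  simp [bracketForm_apply, symplectic_apply, Pi.single_apply]

/-- An automorphism multiplies the bracket form by a nonzero scalar. -/
theorem exists_bracketForm_scale (hn : 0 < n) (Φ : HeisProd n k ≃ₗ⁅ℝ⁆ HeisProd n k) :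
    ∃ c : ℝ, c ≠ 0 ∧ ∀ u v, bracketForm n k (Φ u) (Φ v) = c * bracketForm n k u v := by
  let x : HeisProd n k := ofPlane (Pi.single ⟨0, hn⟩ 1, 0)
  let y : HeisProd n k := ofPlane (0, Pi.single ⟨0, hn⟩ 1)
  have hz : Φ (z 0) = bracketForm n k (Φ x) (Φ y) • z 0 := by
    have h1 : (z 0 : HeisProd n k) = ⁅x, y⁆ := by rw [lie_eq, bracketForm_single, one_smul]
    conv_lhs => rw [h1, LieEquiv.map_lie, lie_eq]
  refine ⟨bracketForm n k (Φ x) (Φ y), fun h0 => ?_, fun u v => ?_⟩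
  · rw [h0, zero_smul] at hz
    exact z_zero_ne (Φ.injective (hz.trans (map_zero Φ.toLinearEquiv).symm))
  · have h1 : Φ ⁅u, v⁆ = bracketForm n k u v • Φ (z 0) := by
      rw [lie_eq]
      exact map_smul Φ.toLinearEquiv _ _
    rw [LieEquiv.map_lie, lie_eq, hz, smul_smul] at h1
    rw [mul_comm (bracketForm n k (Φ x) (Φ y))]
    exact smul_left_injective ℝ z_zero_ne h1

/-- If no nonzero vector supported on `S` is mapped to a vector which vanishes on `T`, then `S` is
at most as large as `T`. -/
theorem card_le_of_support (S T : Fin n → Prop) [DecidablePred S] [DecidablePred T]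
    (f : (Fin n → ℝ) × (Fin n → ℝ) →ₗ[ℝ] (Fin n → ℝ) × (Fin n → ℝ))
    (h : ∀ x, (∀ i, ¬ S i → x.1 i = 0 ∧ x.2 i = 0) →
      (∀ i, T i → (f x).1 i = 0 ∧ (f x).2 i = 0) → x = 0) :
    Fintype.card {i // S i} ≤ Fintype.card {i // T i} := by
  let E := Function.ExtendByZero.linearMap ℝ (Subtype.val : {i // S i} → Fin n)
  let R := LinearMap.funLeft ℝ ℝ (Subtype.val : {i // T i} → Fin n)
  -- Extend by zero from `S`, apply `f`, restrict to `T`: the hypothesis says that this is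
  -- injective, and the dimensions are twice the cardinalities.
  let G := R.prodMap R ∘ₗ f ∘ₗ E.prodMap E
  have hE : Function.Injective E := fun x y hxy => by
    funext i
    have h1 := congrFun hxy i.1
    simpa [E, Subtype.val_injective.extend_apply] using h1
  have hE0 : ∀ x i, ¬ S i → E x i = 0 := fun x i hi => by
    have h1 : ¬ ∃ j : {i // S i}, j.1 = i := by
      rintro ⟨j, rfl⟩
      exact hi j.2
    simp [E, Function.extend_apply' _ _ _ h1]
  have hG : Function.Injective G := by
    rw [← LinearMap.ker_eq_bot, LinearMap.ker_eq_bot']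
    intro x hx
    have h1 := h (E.prodMap E x) (fun i hi => ⟨hE0 _ i hi, hE0 _ i hi⟩) fun i hi =>
      ⟨congrFun (congrArg Prod.fst hx) ⟨i, hi⟩, congrFun (congrArg Prod.snd hx) ⟨i, hi⟩⟩
    exact Prod.ext (hE ((congrArg Prod.fst h1).trans (map_zero E).symm))
      (hE ((congrArg Prod.snd h1).trans (map_zero E).symm))
  have h2 := LinearMap.finrank_le_finrank_of_injective hG
  simp only [Module.finrank_prod, Module.finrank_fintype_fun_eq_card] at h2
  omega

theorem card_subtype_lt {p : ℕ} (hp : p ≤ n) : Fintype.card {i : Fin n // (i : ℕ) < p} = p := by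
  rw [Fintype.card_subtype, Fin.card_filter_val_lt, min_eq_right hp]

theorem card_subtype_not_lt {p : ℕ} (hp : p ≤ n) :
    Fintype.card {i : Fin n // ¬ (i : ℕ) < p} = n - p := by
  rw [Fintype.card_subtype_compl, card_subtype_lt hp, Fintype.card_fin]

/-- Inertia. The induced map `f` of the plane satisfies `Q_q (f x) = c * Q_p x`, where `Q_p x = ω(x,
J x)` is positive definite on the `n - p` coordinate planes `i ≥ p`. If `c > 0`, projecting `f` to
the planes `i ≥ q` is injective there, so `n - p ≤ n - q`; if `c < 0`, projecting to the planes `i <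
q` is, so `n - p ≤ q`. -/
theorem le_or_le_add_of_equivalent {p q : ℕ} (hp : p ≤ n) (hq : q ≤ n)
    (h : (standard n k p).1.Equivalent (standard n k q).1) : q ≤ p ∨ n ≤ p + q := by
  rcases Nat.eq_zero_or_pos n with rfl | hn
  · right; omega
  obtain ⟨Φ, hΦ⟩ := h
  obtain ⟨c, hc0, hc⟩ := exists_bracketForm_scale hn Φ
  let f := toPlane ∘ₗ Φ.toLinearEquiv.toLinearMap ∘ₗ ofPlane
  have hf : ∀ x, ∑ i : Fin n, sgn q i * ((f x).1 i ^ 2 + (f x).2 i ^ 2) =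
      c * ∑ i : Fin n, sgn p i * (x.1 i ^ 2 + x.2 i ^ 2) := fun x => by
    have h1 := hc (ofPlane x) ((standard n k p).1.J (ofPlane x))
    rw [hΦ, bracketForm_apply, bracketForm_apply, toPlane_standard, toPlane_standard,
      toPlane_ofPlane, symplectic_planeMap_self, symplectic_planeMap_self] at h1
    exact h1
  have hpos : ∀ x : (Fin n → ℝ) × (Fin n → ℝ),
      (∀ i : Fin n, ¬ ¬ (i : ℕ) < p → x.1 i = 0 ∧ x.2 i = 0) →
      ∑ i : Fin n, sgn p i * (x.1 i ^ 2 + x.2 i ^ 2) ≤ 0 → x = 0 := fun x hx hle => by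
    have h1 : ∀ i : Fin n, sgn p i * (x.1 i ^ 2 + x.2 i ^ 2) = x.1 i ^ 2 + x.2 i ^ 2 := fun i => by
      by_cases hi : (i : ℕ) < p
      · obtain ⟨h1, h2⟩ := hx i (not_not.mpr hi)
        rw [h1, h2]; ring
      · rw [sgn, if_neg hi, one_mul]
    rw [Finset.sum_congr rfl fun i _ => h1 i] at hle
    have h2 := (Finset.sum_eq_zero_iff_of_nonneg fun i _ => by positivity).mp
      (le_antisymm hle (Finset.sum_nonneg fun i _ => by positivity))
    refine Prod.ext (funext fun i => ?_) (funext fun i => ?_)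
    · have h3 := h2 i (Finset.mem_univ i)
      exact pow_eq_zero_iff two_ne_zero |>.mp (by nlinarith [sq_nonneg (x.1 i), sq_nonneg (x.2 i)])
    · have h3 := h2 i (Finset.mem_univ i)
      exact pow_eq_zero_iff two_ne_zero |>.mp (by nlinarith [sq_nonneg (x.1 i), sq_nonneg (x.2 i)])
  rcases lt_or_gt_of_ne hc0 with hneg | hcpos
  · right
    have h1 := card_le_of_support (fun i : Fin n => ¬ (i : ℕ) < p) (fun i : Fin n => (i : ℕ) < q) f
      fun x hx hy => hpos x hx (by
        have h2 : 0 ≤ ∑ i : Fin n, sgn q i * ((f x).1 i ^ 2 + (f x).2 i ^ 2) :=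
          Finset.sum_nonneg fun i _ => by
            by_cases hi : (i : ℕ) < q
            · rw [(hy i hi).1, (hy i hi).2]; simp
            · rw [sgn, if_neg hi]; positivity
        rw [hf] at h2
        exact nonpos_of_mul_nonneg_right h2 hneg)
    rw [card_subtype_not_lt hp, card_subtype_lt hq] at h1
    omega
  · left
    have h1 := card_le_of_support (fun i : Fin n => ¬ (i : ℕ) < p)
      (fun i : Fin n => ¬ (i : ℕ) < q) f
      fun x hx hy => hpos x hx (by
        have h2 : ∑ i : Fin n, sgn q i * ((f x).1 i ^ 2 + (f x).2 i ^ 2) ≤ 0 :=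
          Finset.sum_nonpos fun i _ => by
            by_cases hi : (i : ℕ) < q
            · rw [sgn, if_pos hi, neg_one_mul, neg_nonpos]; positivity
            · rw [(hy i hi).1, (hy i hi).2]; simp
        rw [hf] at h2
        exact nonpos_of_mul_nonpos_right h2 hcpos)
    rw [card_subtype_not_lt hp, card_subtype_not_lt hq] at h1
    omega

theorem eq_of_standard_equivalent {p q : ℕ} (hp : p ≤ n / 2) (hq : q ≤ n / 2)
    (h : (standard n k p).1.Equivalent (standard n k q).1) : p = q := by
  have h1 := le_or_le_add_of_equivalent (by omega) (by omega) h
  have h2 := le_or_le_add_of_equivalent (by omega) (by omega)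
    (equivalenceSetoid.iseqv.symm (x := standard n k p) (y := standard n k q) h)
  -- Within the range `p, q ≤ n / 2`, the alternative `n ≤ p + q` forces `p = q = n / 2`.
  omega

/-! ### Existence of balanced metrics -/

/-- The balanced condition in a unitary basis which diagonalizes `ω(·, J·)`. -/
theorem isBalanced_iff_sum_eq_zero (hn : 2 ≤ n) (J : AbelianComplexStructure (HeisProd n k))
    (m : HermitianMetric J.1) {ι : Type*} [Fintype ι] [DecidableEq ι]
    (hι : Fintype.card ι = n + k + 1) (u : ι → HeisProd n k) (μ : ι → ℝ)
    (hu : ∀ i j, m.g (u i) (u j) = if i = j then 1 else 0)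
    (huJ : ∀ i j, m.g (u i) (J.1.J (u j)) = 0)
    (hω0 : ∀ i j, bracketForm n k (u i) (u j) = 0)
    (hμ : ∀ i j, bracketForm n k (u i) (J.1.J (u j)) = if i = j then μ i else 0) :
    m.IsBalanced ↔ ∑ i, μ i = 0 :=
  m.isBalanced_iff (M := n + k - 1) (by rw [finrank_eq]; omega) (bracketForm n k) bracketForm_swap
    z_zero_ne bracketForm_z_zero lie_eq (bracketForm_J J) (by omega) u μ hu huJ hω0 hμ

/-- Transport to `J₀` writes each `c * μ i` as a sum of squares, so all `μ i` have the same weak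
sign. A vanishing trace then makes them all zero, hence `ω = 0`, against `[e_i, f_i] = z₀`. -/
theorem not_admitsBalanced_of_equivalent_J₀ (hn : 2 ≤ n) (J : AbelianComplexStructure (HeisProd n k))
    (hJ : J.1.Equivalent (J₀ n k).1) : ¬ J.1.AdmitsBalanced := by
  rintro ⟨m, hm⟩
  obtain ⟨Φ, hΦ⟩ := hJ
  obtain ⟨c, hc0, hc⟩ := exists_bracketForm_scale (by omega) Φ
  let h : LinearMap.BilinForm ℝ (HeisProd n k) := (bracketForm n k).compRight J.1.J
  have hh : ∀ x y, h x y = bracketForm n k x (J.1.J y) := fun _ _ => rfl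
  obtain ⟨u, μ, hu, huJ, hμ, hμJ⟩ := exists_unitary_diagonal J.1.J J.1.sq m.g h m.symm m.pos m.compat
    (fun x y => by rw [hh, hh, ← bracketForm_J J, J.1.sq, map_neg, ← bracketForm_swap])
    (fun x y => by rw [hh, hh, bracketForm_J]) finrank_eq.symm
  have h0 : ∀ i j, bracketForm n k (u i) (u j) = 0 := fun i j => by
    have h1 := hμJ i j
    rwa [hh, J.1.sq, map_neg, neg_eq_zero] at h1
  have hsum := (isBalanced_iff_sum_eq_zero hn J m (Fintype.card_fin _) u μ hu huJ h0 hμ).mp hm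
  have hnn : ∀ i, 0 ≤ c * μ i := fun i => by
    have h1 := hc (u i) (J.1.J (u i))
    have h2 := hμ i i
    rw [if_pos rfl, hh] at h2
    rw [hΦ, ← standard_zero, h2, bracketForm_apply, toPlane_standard,
      symplectic_planeMap_self] at h1
    rw [← h1]
    refine Finset.sum_nonneg fun j _ => ?_
    rw [sgn, if_neg (Nat.not_lt_zero _)]
    positivity
  have hμ0 : ∀ i, μ i = 0 := fun i => by
    have h1 : ∑ i, c * μ i = 0 := by rw [← Finset.mul_sum, hsum, mul_zero]
    have h2 := (Finset.sum_eq_zero_iff_of_nonneg fun i _ => hnn i).mp h1 i (Finset.mem_univ i)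
    exact (mul_eq_zero.mp h2).resolve_left hc0
  have hzero : ∀ i, bracketForm n k (u i) = 0 := fun i =>
    linearForm_eq_zero_of_unitary J.1.J m.g m.symm m.compat finrank_eq.symm u hu huJ _ (h0 i)
      fun j => by
        have h2 := hμ i j
        rw [hh] at h2
        rw [h2, hμ0, ite_self]
  have hzero' : ∀ x, bracketForm n k x = 0 := fun x =>
    linearForm_eq_zero_of_unitary J.1.J m.g m.symm m.compat finrank_eq.symm u hu huJ _
      (fun i => by rw [bracketForm_swap (u i), hzero, LinearMap.zero_apply, neg_zero])
      (fun i => by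
        rw [bracketForm_swap (J.1.J (u i)), ← bracketForm_J J, J.1.sq, map_neg,
          LinearMap.neg_apply, hzero, LinearMap.zero_apply, neg_zero, neg_zero])
  have h1 := bracketForm_single (n := n) (k := k) ⟨0, by omega⟩
  rw [hzero', LinearMap.zero_apply] at h1
  exact zero_ne_one h1

variable (n) in
/-- The diagonal inner product with the given weights. -/
noncomputable def weightedForm (w : Fin n → ℝ) :
    LinearMap.BilinForm ℝ ((Fin n → ℝ) × (Fin n → ℝ)) :=
  ∑ i, w i • (LinearMap.BilinForm.linMulLin
      (LinearMap.proj i ∘ₗ LinearMap.fst ℝ _ _) (LinearMap.proj i ∘ₗ LinearMap.fst ℝ _ _) +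
    LinearMap.BilinForm.linMulLin
      (LinearMap.proj i ∘ₗ LinearMap.snd ℝ _ _) (LinearMap.proj i ∘ₗ LinearMap.snd ℝ _ _))

theorem weightedForm_apply (w : Fin n → ℝ) (x y : (Fin n → ℝ) × (Fin n → ℝ)) :
    weightedForm n w x y = ∑ i, w i * (x.1 i * y.1 i + x.2 i * y.2 i) := by
  simp [weightedForm, LinearMap.sum_apply, mul_add]

/-- There are `p` negative terms of weight `n - p` and `n - p` positive terms of weight `p`. -/
theorem sum_sgn_mul_weight {p : ℕ} (hp : p ≤ n) :
    ∑ i : Fin n, sgn p i * (if (i : ℕ) < p then ((n - p : ℕ) : ℝ) else p) = 0 := by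
  have h1 : ∀ i : Fin n, sgn p i * (if (i : ℕ) < p then ((n - p : ℕ) : ℝ) else p) =
      if (i : ℕ) < p then -((n - p : ℕ) : ℝ) else p := fun i => by
    unfold sgn
    split_ifs <;> ring
  rw [Finset.sum_congr rfl fun i _ => h1 i, Finset.sum_ite, Finset.sum_const, Finset.sum_const,
    ← Fintype.card_subtype, ← Fintype.card_subtype, card_subtype_lt hp, card_subtype_not_lt hp,
    nsmul_eq_mul, nsmul_eq_mul]
  ring

/-- Weighting the `i`-th plane by `(t i)⁻¹` makes `√(t i) e_i` a unit vector with diagonal entry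
`sgn p i * t i`. The centre contributes 0, so the weights `t` above give trace zero; they are
positive because `0 < p < n`. -/
theorem standard_admitsBalanced (hn : 2 ≤ n) {p : ℕ} (hp : 0 < p) (hpn : p < n) :
    (standard n k p).1.AdmitsBalanced := by
  let t : Fin n → ℝ := fun i => if (i : ℕ) < p then ((n - p : ℕ) : ℝ) else p
  have ht : ∀ i, 0 < t i := fun i => by
    simp only [t]
    split_ifs
    · exact_mod_cast Nat.sub_pos_of_lt hpn
    · exact_mod_cast hp
  let gP := weightedForm n fun i => (t i)⁻¹
  have hgP : ∀ x y, gP x y = ∑ i, (t i)⁻¹ * (x.1 i * y.1 i + x.2 i * y.2 i) :=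
    weightedForm_apply _
  have hgPnn : ∀ x, 0 ≤ gP x x := fun x => by
    rw [hgP]
    exact Finset.sum_nonneg fun i _ => mul_nonneg (inv_pos.mpr (ht i)).le
      (add_nonneg (mul_self_nonneg _) (mul_self_nonneg _))
  have hgP0 : ∀ x, gP x x = 0 → x = 0 := fun x hx => by
    rw [hgP, Finset.sum_eq_zero_iff_of_nonneg fun i _ => mul_nonneg (inv_pos.mpr (ht i)).le
      (add_nonneg (mul_self_nonneg _) (mul_self_nonneg _))] at hx
    have h1 : ∀ i, x.1 i * x.1 i + x.2 i * x.2 i = 0 := fun i =>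
      (mul_eq_zero.mp (hx i (Finset.mem_univ i))).resolve_left (inv_pos.mpr (ht i)).ne'
    exact Prod.ext (funext fun i => mul_self_eq_zero.mp
        (by nlinarith [h1 i, mul_self_nonneg (x.1 i), mul_self_nonneg (x.2 i)]))
      (funext fun i => mul_self_eq_zero.mp
        (by nlinarith [h1 i, mul_self_nonneg (x.1 i), mul_self_nonneg (x.2 i)]))
  obtain ⟨gZ, hgZs, hgZp, hgZJ⟩ := exists_invariant_inner (rotMap k) rotMap_rotMap
  -- Diagonalizing the zero form serves only to produce a unitary basis of the centre.
  obtain ⟨c, -, hc, hcJ, -, -⟩ := exists_unitary_diagonal (N := k + 1) (rotMap k) rotMap_rotMap gZ 0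
    hgZs hgZp hgZJ (fun _ _ => rfl) (fun _ _ => rfl) (by simp; ring)
  let J := standard n k p
  let m : HermitianMetric J.1 :=
    { g := gP.comp toPlane toPlane + gZ.comp toCenter toCenter
      symm := fun x y => by
        simp only [LinearMap.add_apply, LinearMap.BilinForm.comp_apply, hgZs (toCenter x), hgP,
          mul_comm]
      pos := fun x hx => by
        simp only [LinearMap.add_apply, LinearMap.BilinForm.comp_apply]
        by_cases hz : toCenter x = 0
        · have h1 : toPlane x ≠ 0 := fun h => hx (ext_coords (by rw [h, map_zero])
            (by rw [hz, map_zero]))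
          have h2 := lt_of_le_of_ne (hgPnn (toPlane x)) fun h => h1 (hgP0 _ h.symm)
          rwa [hz, map_zero, add_zero]
        · exact add_pos_of_nonneg_of_pos (hgPnn _) (hgZp _ hz)
      compat := fun x y => by
        simp only [LinearMap.add_apply, LinearMap.BilinForm.comp_apply, J, toPlane_standard,
          toCenter_standard, hgZJ]
        congr 1
        rw [hgP, hgP]
        refine Finset.sum_congr rfl fun i _ => ?_
        simp only [planeMap_apply]
        linear_combination ((t i)⁻¹ * ((toPlane x).1 i * (toPlane y).1 i +
          (toPlane x).2 i * (toPlane y).2 i)) * sgn_mul_self p i }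
  have hm : ∀ x y, m.g x y = gP (toPlane x) (toPlane y) + gZ (toCenter x) (toCenter y) :=
    fun _ _ => rfl
  let u : Fin n ⊕ Fin (k + 1) → HeisProd n k :=
    Sum.elim (fun i => ofPlane (Pi.single i √(t i), 0)) fun j => ofCenter (c j)
  have hsq : ∀ i, √(t i) * √(t i) = t i := fun i => Real.mul_self_sqrt (ht i).le
  have hinv : ∀ i, (t i)⁻¹ * (√(t i) * √(t i)) = 1 := fun i => by
    rw [hsq, inv_mul_cancel₀ (ht i).ne']
  refine ⟨m, (isBalanced_iff_sum_eq_zero hn J m (by simp; ring) u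
    (Sum.elim (fun i => sgn p i * t i) fun _ => 0) ?_ ?_ ?_ ?_).mpr ?_⟩
  · rintro (i | i) (j | j)
    · simp only [hm, u, Sum.elim_inl, toPlane_ofPlane, toCenter_ofPlane, hgP, Sum.inl.injEq]
      by_cases hij : i = j
      · subst hij
        simp [Pi.single_apply, hinv]
      · simp [Pi.single_apply, hij, Ne.symm hij]
    · simp [hm, u]
    · simp [hm, u]
    · simp [hm, u, hc]
  · rintro (i | i) (j | j)
    · simp [hm, u, J, toPlane_standard, toCenter_standard, hgP, planeMap_apply]
    · simp [hm, u, J, toPlane_standard, toCenter_standard]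
    · simp [hm, u, J, toPlane_standard, toCenter_standard]
    · simp [hm, u, J, toPlane_standard, toCenter_standard, hcJ]
  · rintro (i | i) (j | j) <;> simp [u, bracketForm_apply, symplectic_apply]
  · rintro (i | i) (j | j)
    · simp only [u, J, Sum.elim_inl, bracketForm_apply, toPlane_standard, toPlane_ofPlane,
        symplectic_apply, planeMap_apply, Sum.inl.injEq]
      by_cases hij : i = j
      · subst hij
        simp [Pi.single_apply]
        linear_combination sgn p i * hsq i
      · simp [Pi.single_apply, hij, Ne.symm hij]
    · simp [u, J, bracketForm_apply, toPlane_standard]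
    · simp [u, J, bracketForm_apply, toPlane_standard]
    · simp [u, J, bracketForm_apply, toPlane_standard]
  · rw [Fintype.sum_sum_type]
    simp only [Sum.elim_inl, Sum.elim_inr, Finset.sum_const_zero, add_zero]
    exact sum_sgn_mul_weight hpn.le

/-! ### Counting the classes -/

variable (n k) in
/-- The class of a standard structure. -/
noncomputable def standardClass (p : Fin (n / 2 + 1)) : AbelianComplexClass (HeisProd n k) :=
  (standard n k p).toClass

theorem toClass_eq_iff {J J' : AbelianComplexStructure (HeisProd n k)} :
    J.toClass = J'.toClass ↔ J.1.Equivalent J'.1 :=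
  Quotient.eq

theorem standardClass_bijective : Function.Bijective (standardClass n k) := by
  constructor
  · intro p q h
    exact Fin.ext (eq_of_standard_equivalent (by omega) (by omega) (toClass_eq_iff.mp h))
  · intro c
    induction c using Quotient.inductionOn with
    | h J =>
      obtain ⟨p, hp, h⟩ := exists_standard_equivalent J
      exact ⟨⟨p, by omega⟩, toClass_eq_iff.mpr h⟩

theorem not_admitsBalanced_J₀_toClass (hn : 2 ≤ n) : ¬ (J₀ n k).toClass.AdmitsBalanced := by
  rintro ⟨J, hJ, hb⟩
  exact not_admitsBalanced_of_equivalent_J₀ hn J (toClass_eq_iff.mp hJ) hb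

theorem standardClass_admitsBalanced_iff (hn : 2 ≤ n) (p : Fin (n / 2 + 1)) :
    (standardClass n k p).AdmitsBalanced ↔ p ≠ 0 := by
  constructor
  · rintro h rfl
    refine not_admitsBalanced_J₀_toClass (k := k) hn ?_
    rw [← standard_zero]
    exact h
  · intro hp
    have hp' : 0 < (p : ℕ) := Nat.pos_of_ne_zero fun h => hp (Fin.ext h)
    exact ⟨_, rfl, standard_admitsBalanced hn hp' (by omega)⟩

end HeisProd
end LieHermitian

theorem proposition4p3 (n k : ℕ) :
    Nat.card (LieHermitian.AbelianComplexClass (LieHermitian.HeisProd n k)) = n / 2 + 1 ∧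
    (2 ≤ n →
      Set.ncard {c : LieHermitian.AbelianComplexClass (LieHermitian.HeisProd n k) |
        c.AdmitsBalanced} = n / 2 ∧
      ¬ (LieHermitian.HeisProd.J₀ n k).toClass.AdmitsBalanced) := by
  have hbij := LieHermitian.HeisProd.standardClass_bijective (n := n) (k := k)
  refine ⟨?_, fun hn => ⟨?_, LieHermitian.HeisProd.not_admitsBalanced_J₀_toClass hn⟩⟩
  · rw [← Nat.card_eq_of_bijective _ hbij, Nat.card_fin]
  · have h1 : {c : LieHermitian.AbelianComplexClass (LieHermitian.HeisProd n k) |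
        c.AdmitsBalanced} =
        LieHermitian.HeisProd.standardClass n k '' {p : Fin (n / 2 + 1) | p ≠ 0} := by
      ext c
      obtain ⟨p, rfl⟩ := hbij.2 c
      rw [Set.mem_ofPred_eq, LieHermitian.HeisProd.standardClass_admitsBalanced_iff hn,
        hbij.1.mem_set_image, Set.mem_ofPred_eq]
    have h2 : {p : Fin (n / 2 + 1) | p ≠ 0} = {0}ᶜ := rfl
    rw [h1, Set.ncard_image_of_injective _ hbij.1, h2, Set.ncard_compl, Set.ncard_singleton,
      Nat.card_fin, Nat.add_sub_cancel]
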